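/- Let $|0\rangle,|1\rangle$ be the standard basis of $\mathbb C^2$. A qubit state is a unit vector of $\mathbb C^2$; for a qubit state $|a\rangle$ let $|a'\rangle$ be the qubit state orthogonal to it (unique up to a phase). We write $a\neq b$ if $|a\rangle,|b\rangle$ are not equal up to a phase. For an $8\times 4$ array $F$ of qubit states the rows $(a,b,c,d)$ of $F$ stand for the product vectors $|\psi\rangle=|a\rangle\otimes|b\rangle\otimes|c\rangle\otimes|d\rangle$ of $\mathcal H_A\otimes\mathcal H_B\otimes\mathcal H_C\otimes\mathcal H_D=(\mathbb C^2)^{\otimes 4}$. Let $$F_1=\begin{bmatrix}0&0&0&0\\0&1&0&1\\1&g_3&h_3&i_3\\1&g_3'&h_3&i_4\\f_5&g_3'&1&i_4'\\f_5&g_3&1&i_3'\\f_5'&0&h_3'&1\\f_5'&1&h_3'&0\end{bmatrix},\quad F_2=\begin{bmatrix}0&0&0&0\\0&1&0&i_2\\1&g_3&h_3&i_3\\1&g_3'&h_3&i_4\\f_5&g_3'&1&i_4'\\f_5&g_3&1&i_3'\\f_5'&1&h_3'&i_2'\\f_5'&0&h_3'&1\end{bmatrix},\quad F_3=\begin{bmatrix}0&0&0&0\\0&1&0&i_2\\1&g_3&h_3&0\\1&g_3'&h_4&i_2\\f_5&g_3'&1&i_2'\\f_5&g_3&1&1\\f_5'&1&h_3'&i_2'\\f_5'&0&h_4'&1\end{bmatrix},$$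 $$F_4=\begin{bmatrix}0&0&0&0\\0&1&0&i_2\\1&g_3&h_3&i_3\\1&g_4&h_3&i_3'\\f_5&g_3'&1&i_3\\f_5&g_4'&1&i_3'\\f_5'&1&h_3'&i_2'\\f_5'&0&h_3'&1\end{bmatrix},\quad F_5=\begin{bmatrix}0&0&0&0\\0&1&0&i_2\\1&g_3&h_3&1\\1&g_3'&h_3&i_2'\\f_5&g_3&1&0\\f_6&g_3'&1&i_2\\f_5'&1&h_3'&i_2'\\f_6'&0&h_3'&1\end{bmatrix},\quad F_6=\begin{bmatrix}0&0&0&0\\0&1&h_2&i_2\\1&g_3&0&i_3\\1&g_3'&h_2&i_4\\f_5&1&h_2'&i_3'\\f_5&0&1&i_4'\\f_5'&g_3&1&i_2'\\f_5'&g_3'&h_2'&1\end{bmatrix},$$ where the qubit states $f_5,f_6,g_3,g_4,h_2,h_3,h_4$ that occur are $\neq 0,1$ and, moreover, - $F_1$: $i_3\neq 0,1,i_4$ and $i_4\neq 0,1$; - $F_2$: $i_2\neq 0,1$ and $i_3\neq i_4,i_4'$; - $F_3$: $h_3\neq h_4$ and $i_2\neq 0,1$; - $F_4$: $g_3\neq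 g_4,g_4'$, $i_2\neq 0,1,i_3,i_3'$ and $i_3\neq 0,1$; - $F_5$: $f_5\neq f_6$ and $i_2\neq 0,1$; - $F_6$: either $i_2\neq 0,i_3',i_4$, $i_3\neq 0,i_4$ and $i_4\neq 0,1$; or $i_3=i_2'$, $i_2\neq 0,1,i_4,i_4'$ and $i_4\neq 0$. A density matrix on $(\mathbb C^2)^{\otimes 4}$ is regarded as a 4-qubit state (parties $A,B,C,D$), a $2\times2\times4$ state (parties $A,B,CD$), or a $4\times4$ state (parties $AB,CD$). In each case it is PPT if its partial transposes with respect to all sets of parties are positive semidefinite, and entangled if it is not a convex combination of projectors onto unit product vectors with respect to these parties. (i) Let $F$ be any array of the form $F_1,\dots,F_6$. Then $\alpha=\frac18\bigl(I-\sum_{\psi}|\psi\rangle\langle\psi|\bigr)$, summed over all eight rows of $F$, is at the same time a 4-qubit, a $2\times2\times4$ and a $4\times4$ PPT entangled state, and it has rank $8$. (ii) Let $F$ be any array of the form $F_1$; $F_2$ with $i_3=i_2$, $i_4=0$ (and $i_2\neq0,1$); $F_3$; $F_4$; $F_5$; or $F_6$ with $i_3=i_2$, $i_2\neq 0,1,i_4,i_4'$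 and $i_4\neq 0,1$. Then $\beta=\frac19\bigl(I-\sum_{\psi}|\psi\rangle\langle\psi|\bigr)$, summed over the last seven rows of $F$ (the first row is removed), is at the same time a 4-qubit, a $2\times2\times4$ and a $4\times4$ PPT entangled state, and it has rank $9$. Moreover, up to scalar factors, the range of $\beta$ contains only finitely many $4\times4$ product vectors, namely at least four and fewer than nine. -/

import Mathlib

open scoped BigOperators ComplexOrder

noncomputable section

namespace FourQubit

/-- A qubit state: a unit vector of `ℂ²`. -/
abbrev Qubit : Type := {v : Fin 2 → ℂ // star v ⬝ᵥ v = 1}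

/-- The computational basis vector `|0⟩`. -/
def k0 : Qubit := ⟨![1, 0], by simp [dotProduct, Fin.sum_univ_two]⟩

/-- The computational basis vector `|1⟩`. -/
def k1 : Qubit := ⟨![0, 1], by simp [dotProduct, Fin.sum_univ_two]⟩

/-- The qubit state `|a'⟩` orthogonal to `|a⟩` (it is unique up to a phase). -/
def perp (a : Qubit) : Qubit :=
  ⟨![-star (a.1 1), star (a.1 0)], by
    have h := a.2
    simp only [dotProduct, Fin.sum_univ_two, Pi.star_apply] at h ⊢
    simp only [Matrix.cons_val_zero, Matrix.cons_val_one, star_neg, star_star]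
    linear_combination h⟩

/-- `|a⟩` and `|b⟩` are different qubit states, that is, they are not equal up to a phase. -/
def Distinct (a b : Qubit) : Prop := ∀ c : ℂ, b.1 ≠ c • a.1

/-- Index set of the computational basis of `(ℂ²)^{⊗4}`; the four positions are the
systems `A`, `B`, `C`, `D`. -/
abbrev Idx : Type := Fin 4 → Fin 2

/-- The 4-qubit product vector `|a, b, c, d⟩`. -/
def ket (r : Fin 4 → Qubit) : Idx → ℂ := fun x => ∏ s, (r s).1 (x s)

/-- The rank-one operator `|v⟩⟨v|`. -/
def proj (v : Idx → ℂ) : Matrix Idx Idx ℂ := Matrix.vecMulVec v (star v)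

section Parties

variable {P : Type} [Fintype P] [DecidableEq P]

/-- Product vectors, when qubit `s` is held by the party `g s`: nonzero vectors that are the
tensor product over the parties `p` of a vector `φ p` of the space of all qubits of `p`. -/
def IsProductVector (g : Fin 4 → P) (v : Idx → ℂ) : Prop :=
  v ≠ 0 ∧ ∃ φ : (p : P) → ({s : Fin 4 // g s = p} → Fin 2) → ℂ,
    ∀ x : Idx, v x = ∏ p, φ p (fun s => x s.1)

/-- Density matrices. -/
def IsState (ρ : Matrix Idx Idx ℂ) : Prop := ρ.PosSemidef ∧ ρ.trace = 1

/-- Fully separable states: convex combinations of normalised product states. -/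
def IsSeparable (g : Fin 4 → P) (ρ : Matrix Idx Idx ℂ) : Prop :=
  ∃ (m : ℕ) (q : Fin m → ℝ) (v : Fin m → Idx → ℂ),
    (∀ k, 0 ≤ q k) ∧ ∑ k, q k = 1 ∧
    (∀ k, IsProductVector g (v k) ∧ star (v k) ⬝ᵥ v k = 1) ∧
    ρ = ∑ k, (q k : ℂ) • proj (v k)

/-- Partial transpose of `ρ` with respect to the set `T` of parties. -/
def partialTranspose (g : Fin 4 → P) (T : Finset P) (ρ : Matrix Idx Idx ℂ) :
    Matrix Idx Idx ℂ :=
  fun x y => ρ (fun s => if g s ∈ T then y s else x s) (fun s => if g s ∈ T then x s else y s)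

/-- `ρ` has positive semidefinite partial transposes with respect to all sets of parties. -/
def IsPPT (g : Fin 4 → P) (ρ : Matrix Idx Idx ℂ) : Prop :=
  ∀ T : Finset P, (partialTranspose g T ρ).PosSemidef

/-- PPT entangled states. -/
def IsPPTEntangled (g : Fin 4 → P) (ρ : Matrix Idx Idx ℂ) : Prop :=
  IsState ρ ∧ IsPPT g ρ ∧ ¬ IsSeparable g ρ

end Parties

/-- The 4-qubit system `A : B : C : D`. -/
def g2222 : Fin 4 → Fin 4 := id

/-- The `2 × 2 × 4` system `A : B : CD`. -/
def g224 : Fin 4 → Fin 3 := ![0, 1, 2, 2]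

/-- The `4 × 4` system `AB : CD`. -/
def g44 : Fin 4 → Fin 2 := ![0, 0, 1, 1]

/-- A 4-qubit, `2 × 2 × 4` and `4 × 4` PPT entangled state at the same time. -/
def IsPPTEntangledInAllSenses (ρ : Matrix Idx Idx ℂ) : Prop :=
  IsPPTEntangled g2222 ρ ∧ IsPPTEntangled g224 ρ ∧ IsPPTEntangled g44 ρ

/-- The product vectors of the `4 × 4` system in the range of `ρ`, up to scalar factors. -/
def productRaysInRange (ρ : Matrix Idx Idx ℂ) : Set (Projectivization ℂ (Idx → ℂ)) :=
  {p | ∃ (v : Idx → ℂ) (hv : v ≠ 0), IsProductVector g44 v ∧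
    v ∈ LinearMap.range ρ.mulVecLin ∧ p = Projectivization.mk ℂ v hv}

/-- An `8 × 4` array of qubit states; its rows are product vectors. -/
abbrev Array84 : Type := Matrix (Fin 8) (Fin 4) Qubit

/-- `(1/8) (I - ∑ |ψ⟩⟨ψ|)`, summed over all eight rows `ψ`. -/
def alpha (F : Array84) : Matrix Idx Idx ℂ :=
  (1 / 8 : ℂ) • (1 - ∑ i : Fin 8, proj (ket (F i)))

/-- `(1/9) (I - ∑ |ψ⟩⟨ψ|)`, summed over all rows `ψ` but the first. -/
def beta (F : Array84) : Matrix Idx Idx ℂ :=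
  (1 / 9 : ℂ) • (1 - ∑ i : Fin 7, proj (ket (F i.succ)))

/-! ### The six arrays -/

def F1 (f5 g3 h3 i3 i4 : Qubit) : Array84 :=
  !![k0,      k0,      k0,      k0;
     k0,      k1,      k0,      k1;
     k1,      g3,      h3,      i3;
     k1,      perp g3, h3,      i4;
     f5,      perp g3, k1,      perp i4;
     f5,      g3,      k1,      perp i3;
     perp f5, k0,      perp h3, k1;
     perp f5, k1,      perp h3, k0]

def F2 (f5 g3 h3 i2 i3 i4 : Qubit) : Array84 :=
  !![k0,      k0,      k0,      k0;
     k0,      k1,      k0,      i2;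
     k1,      g3,      h3,      i3;
     k1,      perp g3, h3,      i4;
     f5,      perp g3, k1,      perp i4;
     f5,      g3,      k1,      perp i3;
     perp f5, k1,      perp h3, perp i2;
     perp f5, k0,      perp h3, k1]

def F3 (f5 g3 h3 h4 i2 : Qubit) : Array84 :=
  !![k0,      k0,      k0,      k0;
     k0,      k1,      k0,      i2;
     k1,      g3,      h3,      k0;
     k1,      perp g3, h4,      i2;
     f5,      perp g3, k1,      perp i2;
     f5,      g3,      k1,      k1;
     perp f5, k1,      perp h3, perp i2;
     perp f5, k0,      perp h4, k1]

def F4 (f5 g3 g4 h3 i2 i3 : Qubit) : Array84 :=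
  !![k0,      k0,      k0,      k0;
     k0,      k1,      k0,      i2;
     k1,      g3,      h3,      i3;
     k1,      g4,      h3,      perp i3;
     f5,      perp g3, k1,      i3;
     f5,      perp g4, k1,      perp i3;
     perp f5, k1,      perp h3, perp i2;
     perp f5, k0,      perp h3, k1]

def F5 (f5 f6 g3 h3 i2 : Qubit) : Array84 :=
  !![k0,      k0,      k0,      k0;
     k0,      k1,      k0,      i2;
     k1,      g3,      h3,      k1;
     k1,      perp g3, h3,      perp i2;
     f5,      g3,      k1,      k0;
     f6,      perp g3, k1,      i2;
     perp f5, k1,      perp h3, perp i2;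
     perp f6, k0,      perp h3, k1]

def F6 (f5 g3 h2 i2 i3 i4 : Qubit) : Array84 :=
  !![k0,      k0,      k0,      k0;
     k0,      k1,      h2,      i2;
     k1,      g3,      k0,      i3;
     k1,      perp g3, h2,      i4;
     f5,      k1,      perp h2, perp i3;
     f5,      k0,      k1,      perp i4;
     perp f5, g3,      k1,      perp i2;
     perp f5, perp g3, perp h2, k1]

/-- `|a⟩` is different from `|0⟩` and from `|1⟩`. -/
def Generic (a : Qubit) : Prop := Distinct a k0 ∧ Distinct a k1

/-! ### The admissible parameters of the six arrays -/

def family1 : Set Array84 :=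
  {F | ∃ f5 g3 h3 i3 i4 : Qubit, Generic f5 ∧ Generic g3 ∧ Generic h3 ∧
    Generic i3 ∧ Distinct i3 i4 ∧ Generic i4 ∧ F = F1 f5 g3 h3 i3 i4}

def family2 : Set Array84 :=
  {F | ∃ f5 g3 h3 i2 i3 i4 : Qubit, Generic f5 ∧ Generic g3 ∧ Generic h3 ∧
    Generic i2 ∧ Distinct i3 i4 ∧ Distinct i3 (perp i4) ∧ F = F2 f5 g3 h3 i2 i3 i4}

def family3 : Set Array84 :=
  {F | ∃ f5 g3 h3 h4 i2 : Qubit, Generic f5 ∧ Generic g3 ∧ Generic h3 ∧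
    Distinct h3 h4 ∧ Generic h4 ∧ Generic i2 ∧ F = F3 f5 g3 h3 h4 i2}

def family4 : Set Array84 :=
  {F | ∃ f5 g3 g4 h3 i2 i3 : Qubit, Generic f5 ∧
    Generic g3 ∧ Distinct g3 g4 ∧ Distinct g3 (perp g4) ∧ Generic g4 ∧ Generic h3 ∧
    Generic i2 ∧ Distinct i2 i3 ∧ Distinct i2 (perp i3) ∧ Generic i3 ∧
    F = F4 f5 g3 g4 h3 i2 i3}

def family5 : Set Array84 :=
  {F | ∃ f5 f6 g3 h3 i2 : Qubit, Generic f5 ∧ Distinct f5 f6 ∧ Generic f6 ∧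
    Generic g3 ∧ Generic h3 ∧ Generic i2 ∧ F = F5 f5 f6 g3 h3 i2}

/-- The last column of the sixth array satisfies either the general inequalities, or
`i₃ = i₂'` with the inequalities of that special case. -/
def family6 : Set Array84 :=
  {F | ∃ f5 g3 h2 i2 i3 i4 : Qubit, Generic f5 ∧ Generic g3 ∧ Generic h2 ∧
    ((Distinct i2 k0 ∧ Distinct i2 (perp i3) ∧ Distinct i2 i4 ∧
        Distinct i3 k0 ∧ Distinct i3 i4 ∧ Generic i4) ∨
      (i3 = perp i2 ∧ Generic i2 ∧ Distinct i2 i4 ∧ Distinct i2 (perp i4) ∧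
        Distinct i4 k0)) ∧
    F = F6 f5 g3 h2 i2 i3 i4}

/-- The second array with `i₃ = i₂` and `i₄ = 0`. -/
def family2special : Set Array84 :=
  {F | ∃ f5 g3 h3 i2 : Qubit, Generic f5 ∧ Generic g3 ∧ Generic h3 ∧
    Generic i2 ∧ F = F2 f5 g3 h3 i2 i2 k0}

/-- The sixth array with `i₃ = i₂`. -/
def family6special : Set Array84 :=
  {F | ∃ f5 g3 h2 i2 i4 : Qubit, Generic f5 ∧ Generic g3 ∧ Generic h2 ∧
    Generic i2 ∧ Distinct i2 i4 ∧ Distinct i2 (perp i4) ∧ Generic i4 ∧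
    F = F6 f5 g3 h2 i2 i2 i4}

end FourQubit

end

/-!
Let `ψ` run over `n` rows of one of the arrays. The rows are product vectors, and any two of them
are orthogonal in one of the four qubits, so they are orthonormal and `1 - ∑ |ψ⟩⟨ψ|` is the
projection onto their orthogonal complement, of rank `16 - n`. A partial transposition replaces
some of the qubits in the rows by their complex conjugates; the new rows are again orthogonal in
one qubit each, so the partial transpose is again a projection (`partialTranspose_complement`).
This gives the rank, the trace and the PPT property.

Entanglement comes from the range criterion: the range of a separable state is spanned by the
product vectors of a decomposition, and these are also product vectors with respect to `AB : CD`.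
Hence a state whose range contains fewer `4 × 4` product vectors, up to scalars, than its rank is
entangled in all three senses (`not_isSeparable_complement`). It remains to count the product
vectors `X ⊗ Y` orthogonal to all rows: at most four for eight rows (rank `8`), and between four and
eight for seven rows (rank `9`).

For each row, `X` is orthogonal to its `AB` part or `Y` is orthogonal to its `CD` part. Let `I` be
the set of rows whose `AB` part is orthogonal to `X`. The `AB` parts of the rows in `I` do not span
`ℂ² ⊗ ℂ²`, nor do the `CD` parts of the other rows. For most `I` this is impossible, for all values
of the parameters; the few remaining `I` determine `X` and `Y` up to scalars, because the rows in
question have rank three on both sides. Only two facts about spanning are needed: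

* if `X` is orthogonal to `|a, b₁⟩` and `|a, b₂⟩` with `b₁ ≠ b₂`, then it is orthogonal to
  `|a⟩ ⊗ ℂ²`, and if this holds for two different states `a`, then `X = 0` (`isNull_of_distinct`,
  `eq_zero_of_isNull`);
* four vectors `|p, r⟩`, `|p', s⟩`, `|q, r'⟩`, `|q', s'⟩` with `p ≠ q'` always span
  (`eq_zero_of_orthogonal_pairs`).

These rules depend only on which entries of a column are equal, orthogonal or known to be different.
This information is recorded in a `Pattern`, and the enumeration of the sets `I` is a finite
computation with it (`Pattern.boundedBy`), as is the proof that four of them always occur and give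
different product vectors (`Pattern.admits`, `Pattern.separated`). For the upper bound it does not
matter that some of the remaining sets `I` occur only for special parameters: only for `h₄ = h₃'` in
the third and `f₆ = f₅'` in the fifth array has the computation to be done separately.
-/

namespace FourQubit

/-! ### Qubits up to a phase -/

/-- The bracket `a₀ b₁ - a₁ b₀` of two qubit states. -/
def bracket (a b : Qubit) : ℂ := a.1 0 * b.1 1 - a.1 1 * b.1 0

/-- The inner product `⟨a|b⟩`. -/
def braket (a b : Qubit) : ℂ := star (a.1 0) * b.1 0 + star (a.1 1) * b.1 1

theorem star_dotProduct_eq_braket (a b : Qubit) : star a.1 ⬝ᵥ b.1 = braket a b := by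
  simp [dotProduct, Fin.sum_univ_two, braket]

theorem braket_self (a : Qubit) : braket a a = 1 := by
  rw [← star_dotProduct_eq_braket]; exact a.2

/-- `|a⟩` and `|b⟩` are equal up to a phase. -/
def Parallel (a b : Qubit) : Prop := ∃ c : ℂ, c ≠ 0 ∧ b.1 = c • a.1

theorem Parallel.refl (a : Qubit) : Parallel a a := ⟨1, one_ne_zero, (one_smul _ _).symm⟩

theorem Parallel.symm {a b : Qubit} (h : Parallel a b) : Parallel b a := by
  obtain ⟨c, hc, h⟩ := h
  exact ⟨c⁻¹, inv_ne_zero hc, by rw [h, smul_smul, inv_mul_cancel₀ hc, one_smul]⟩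

theorem parallel_of_eq_smul {a b : Qubit} {c : ℂ} (h : b.1 = c • a.1) : Parallel a b := by
  refine ⟨c, fun hc => ?_, h⟩
  have := b.2
  rw [h, hc] at this
  simp at this

theorem parallel_of_not_distinct {a b : Qubit} (h : ¬ Distinct a b) : Parallel a b := by
  simp only [Distinct, not_forall, not_not] at h
  exact parallel_of_eq_smul h.choose_spec

theorem parallel_of_bracket_eq_zero {a b : Qubit} (h : bracket a b = 0) : Parallel a b := by
  refine parallel_of_eq_smul (c := braket a b) ?_
  have ha := braket_self a
  simp only [bracket, braket] at *
  ext s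
  fin_cases s
  · simp only [Fin.zero_eta, Pi.smul_apply, smul_eq_mul]
    linear_combination -(b.1 0) * ha - star (a.1 1) * h
  · simp only [Fin.mk_one, Pi.smul_apply, smul_eq_mul]
    linear_combination -(b.1 1) * ha + star (a.1 0) * h

theorem Distinct.bracket_ne_zero {a b : Qubit} (h : Distinct a b) : bracket a b ≠ 0 := by
  intro h0
  obtain ⟨c, -, hc⟩ := parallel_of_bracket_eq_zero h0
  exact h c hc

theorem distinct_of_bracket_ne_zero {a b : Qubit} (h : bracket a b ≠ 0) : Distinct a b := by
  intro c hc
  apply h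
  simp only [bracket, hc, Pi.smul_apply, smul_eq_mul]
  ring

theorem Distinct.symm {a b : Qubit} (h : Distinct a b) : Distinct b a := by
  apply distinct_of_bracket_ne_zero
  have := h.bracket_ne_zero
  contrapose! this
  simp only [bracket] at *
  linear_combination -this

theorem Distinct.of_parallel {a b a' b' : Qubit} (h : Distinct a b) (ha : Parallel a a')
    (hb : Parallel b b') : Distinct a' b' := by
  obtain ⟨c, hc, ha⟩ := ha
  obtain ⟨d, hd, hb⟩ := hb
  apply distinct_of_bracket_ne_zero
  have h1 := h.bracket_ne_zero
  have : bracket a' b' = c * d * bracket a b := by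
    simp only [bracket, ha, hb, Pi.smul_apply, smul_eq_mul]; ring
  rw [this]
  exact mul_ne_zero (mul_ne_zero hc hd) h1

theorem perp_zero (a : Qubit) : (perp a).1 0 = -star (a.1 1) := rfl

theorem perp_one (a : Qubit) : (perp a).1 1 = star (a.1 0) := rfl

theorem bracket_perp_perp (a b : Qubit) : bracket (perp a) (perp b) = star (bracket a b) := by
  simp only [bracket, perp_zero, perp_one, star_sub, star_mul']
  ring

theorem Distinct.perp_perp {a b : Qubit} (h : Distinct a b) : Distinct (perp a) (perp b) := by
  apply distinct_of_bracket_ne_zero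
  rw [bracket_perp_perp]
  exact star_ne_zero.2 h.bracket_ne_zero

theorem distinct_perp (a : Qubit) : Distinct a (perp a) := by
  apply distinct_of_bracket_ne_zero
  have := braket_self a
  simp only [bracket, braket, perp_zero, perp_one] at *
  have h : a.1 0 * star (a.1 0) - a.1 1 * -star (a.1 1) = 1 := by linear_combination this
  rw [h]
  exact one_ne_zero

theorem braket_perp_right (a : Qubit) : braket a (perp a) = 0 := by
  simp only [braket, perp_zero, perp_one]; ring

theorem bracket_perp_left (a b : Qubit) : bracket (perp a) b = -braket a b := by
  simp only [bracket, braket, perp_zero, perp_one]; ring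

theorem parallel_perp_of_braket_eq_zero {a b : Qubit} (h : braket a b = 0) :
    Parallel (perp a) b :=
  parallel_of_bracket_eq_zero (by rw [bracket_perp_left, h, neg_zero])

theorem parallel_perp_perp (a : Qubit) : Parallel (perp (perp a)) a :=
  parallel_of_bracket_eq_zero (by
    rw [bracket_perp_left]; simp only [braket, perp_zero, perp_one, star_neg, star_star]; ring)

theorem Parallel.perp {a b : Qubit} (h : Parallel a b) :
    Parallel (FourQubit.perp a) (FourQubit.perp b) := by
  by_contra h'
  obtain ⟨c, -, hc⟩ := h
  have h2 : Distinct (FourQubit.perp a) (FourQubit.perp b) := by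
    by_contra h3
    exact h' (parallel_of_not_distinct h3)
  refine (h2.perp_perp.of_parallel (parallel_perp_perp a) (parallel_perp_perp b)) c hc

theorem Parallel.trans {a b c : Qubit} (h : Parallel a b) (h' : Parallel b c) :
    Parallel a c := by
  obtain ⟨x, hx, h⟩ := h
  obtain ⟨y, hy, h'⟩ := h'
  exact ⟨y * x, mul_ne_zero hy hx, by rw [h', h, smul_smul]⟩

theorem braket_eq_zero_of_parallel {a b a' b' : Qubit} (h : braket a b = 0)
    (ha : Parallel a a') (hb : Parallel b b') : braket a' b' = 0 := by
  obtain ⟨c, -, ha⟩ := ha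
  obtain ⟨d, -, hb⟩ := hb
  simp only [braket, ha, hb, Pi.smul_apply, smul_eq_mul, star_mul'] at *
  linear_combination star c * d * h

/-! ### Forms on two qubits -/

/-- A vector of `ℂ² ⊗ ℂ²`, by its coordinates. -/
abbrev Form : Type := Fin 2 → Fin 2 → ℂ

/-- The inner product `⟨a, b|X⟩` of a two-qubit product vector with `X`. -/
def ev (X : Form) (a b : Qubit) : ℂ :=
  ∑ s, ∑ t, star (a.1 s) * star (b.1 t) * X s t

theorem ev_eq (X : Form) (a b : Qubit) : ev X a b =
    star (a.1 0) * star (b.1 0) * X 0 0 + star (a.1 0) * star (b.1 1) * X 0 1 +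
    star (a.1 1) * star (b.1 0) * X 1 0 + star (a.1 1) * star (b.1 1) * X 1 1 := by
  simp only [ev, Fin.sum_univ_two]; ring

theorem ev_swap (X : Form) (a b : Qubit) : ev (fun s t => X t s) b a = ev X a b := by
  simp only [ev_eq]; ring

theorem ev_sub_smul (X Y : Form) (c : ℂ) (a b : Qubit) :
    ev (X - c • Y) a b = ev X a b - c * ev Y a b := by
  simp only [ev_eq, Pi.sub_apply, Pi.smul_apply, smul_eq_mul]; ring

theorem ev_parallel {X : Form} {a b a' b' : Qubit} (ha : Parallel a a') (hb : Parallel b b') :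
    ev X a b = 0 ↔ ev X a' b' = 0 := by
  obtain ⟨c, hc, ha⟩ := ha
  obtain ⟨d, hd, hb⟩ := hb
  have : ev X a' b' = star c * star d * ev X a b := by
    simp only [ev_eq, ha, hb, Pi.smul_apply, smul_eq_mul, star_mul']; ring
  rw [this]
  simp [hc, hd]

/-- `X` is orthogonal to `|a⟩ ⊗ ℂ²`. -/
def IsNull (X : Form) (a : Qubit) : Prop := ∀ b : Qubit, ev X a b = 0

theorem isNull_of_distinct {X : Form} {a b₁ b₂ : Qubit} (h : Distinct b₁ b₂)
    (h₁ : ev X a b₁ = 0) (h₂ : ev X a b₂ = 0) : IsNull X a := by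
  intro b
  have hb : star (bracket b₁ b₂) ≠ 0 := star_ne_zero.2 h.bracket_ne_zero
  apply (mul_eq_zero.1 (?_ : star (bracket b₁ b₂) * ev X a b = 0)).resolve_left hb
  simp only [ev_eq, bracket, star_sub, star_mul'] at *
  linear_combination
    (star (b.1 0) * star (b₂.1 1) - star (b.1 1) * star (b₂.1 0)) * h₁ +
    (star (b.1 1) * star (b₁.1 0) - star (b.1 0) * star (b₁.1 1)) * h₂

theorem eq_zero_of_isNull {X : Form} {a₁ a₂ : Qubit} (h : Distinct a₁ a₂)
    (h₁ : IsNull X a₁) (h₂ : IsNull X a₂) : X = 0 := by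
  have key : ∀ a b : Qubit, ev X a b = 0 := fun a b => by
    rw [← ev_swap]
    exact isNull_of_distinct h (by rw [ev_swap]; exact h₁ b) (by rw [ev_swap]; exact h₂ b) a
  have e00 := key k0 k0
  have e01 := key k0 k1
  have e10 := key k1 k0
  have e11 := key k1 k1
  simp [ev_eq, k0, k1] at e00 e01 e10 e11
  ext s t
  fin_cases s <;> fin_cases t <;> simpa

/-- The vectors `|p, r⟩`, `|q', s'⟩` are orthogonal to `|p', s⟩`, `|q, r'⟩`. If `|p⟩ ≠ |q'⟩`, then
the two vectors of each pair are independent, and the four vectors span `ℂ² ⊗ ℂ²`. -/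
theorem eq_zero_of_orthogonal_pairs {X : Form} {p q r s : Qubit} (h : Distinct p (perp q))
    (h₁ : ev X p r = 0) (h₂ : ev X (perp p) s = 0) (h₃ : ev X q (perp r) = 0)
    (h₄ : ev X (perp q) (perp s) = 0) : X = 0 := by
  -- `X = p ⊗ ξ + p' ⊗ η` with `ξ = x r'` and `η = y s'`
  obtain ⟨x, hx0, hx1⟩ : ∃ x, star (p.1 0) * X 0 0 + star (p.1 1) * X 1 0 = x * (perp r).1 0 ∧
      star (p.1 0) * X 0 1 + star (p.1 1) * X 1 1 = x * (perp r).1 1 := by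
    refine ⟨ev X p (perp r), ?_, ?_⟩ <;> have hr := braket_self r <;>
      simp only [ev_eq, braket, perp_zero, perp_one, star_neg, star_star] at *
    · linear_combination -(star (p.1 0) * X 0 0 + star (p.1 1) * X 1 0) * hr + r.1 0 * h₁
    · linear_combination -(star (p.1 0) * X 0 1 + star (p.1 1) * X 1 1) * hr + r.1 1 * h₁
  obtain ⟨y, hy0, hy1⟩ : ∃ y, -(p.1 1) * X 0 0 + p.1 0 * X 1 0 = y * (perp s).1 0 ∧
      -(p.1 1) * X 0 1 + p.1 0 * X 1 1 = y * (perp s).1 1 := by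
    refine ⟨ev X (perp p) (perp s), ?_, ?_⟩ <;> have hs := braket_self s <;>
      simp only [ev_eq, braket, perp_zero, perp_one, star_neg, star_star] at *
    · linear_combination -(-(p.1 1) * X 0 0 + p.1 0 * X 1 0) * hs + s.1 0 * h₂
    · linear_combination -(-(p.1 1) * X 0 1 + p.1 0 * X 1 1) * hs + s.1 1 * h₂
  have hp := braket_self p
  have hr := braket_self (perp r)
  have hs := braket_self (perp s)
  have X00 : X 0 0 = p.1 0 * (x * (perp r).1 0) - star (p.1 1) * (y * (perp s).1 0) := by
    rw [← hx0, ← hy0]; simp only [braket] at hp; linear_combination -(X 0 0) * hp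
  have X01 : X 0 1 = p.1 0 * (x * (perp r).1 1) - star (p.1 1) * (y * (perp s).1 1) := by
    rw [← hx1, ← hy1]; simp only [braket] at hp; linear_combination -(X 0 1) * hp
  have X10 : X 1 0 = p.1 1 * (x * (perp r).1 0) + star (p.1 0) * (y * (perp s).1 0) := by
    rw [← hx0, ← hy0]; simp only [braket] at hp; linear_combination -(X 1 0) * hp
  have X11 : X 1 1 = p.1 1 * (x * (perp r).1 1) + star (p.1 0) * (y * (perp s).1 1) := by
    rw [← hx1, ← hy1]; simp only [braket] at hp; linear_combination -(X 1 1) * hp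
  -- the conditions at `|q, r'⟩` and `|q', s'⟩`
  have e₃ : braket q p * x + braket q (perp p) * braket (perp r) (perp s) * y = 0 := by
    rw [ev_eq, X00, X01, X10, X11] at h₃
    simp only [braket] at *
    rw [perp_zero p, perp_one p]
    linear_combination h₃ - (star (q.1 0) * p.1 0 + star (q.1 1) * p.1 1) * x * hr
  have e₄ : -star (braket q (perp p)) * star (braket (perp r) (perp s)) * x +
      star (braket q p) * y = 0 := by
    rw [ev_eq, X00, X01, X10, X11] at h₄
    simp only [braket, star_add, star_mul', star_star] at *
    rw [perp_zero p, perp_one p]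
    rw [perp_zero q, perp_one q] at h₄
    simp only [star_neg, star_star] at *
    linear_combination h₄ - (q.1 0 * star (p.1 0) + q.1 1 * star (p.1 1)) * y * hs
  have hA : braket q p ≠ 0 := by
    have := h.symm.bracket_ne_zero
    rwa [bracket_perp_left, neg_ne_zero] at this
  generalize braket q p = A at *
  generalize braket q (perp p) = B at *
  generalize braket (perp r) (perp s) = c at *
  -- the determinant of the two equations for `x` and `y` is positive
  have hpos : A * star A + (B * c) * star (B * c) ≠ 0 := by
    rw [Complex.star_def, Complex.mul_conj, Complex.mul_conj, ← Complex.ofReal_add]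
    have h1 := Complex.normSq_pos.2 hA
    have h2 := Complex.normSq_nonneg (B * c)
    exact_mod_cast (add_pos_of_pos_of_nonneg h1 h2).ne'
  have hx : x = 0 := by
    apply (mul_eq_zero.1 (?_ : (A * star A + (B * c) * star (B * c)) * x = 0)).resolve_left hpos
    rw [star_mul']
    linear_combination star A * e₃ - B * c * e₄
  have hy : y = 0 := by
    rw [hx, mul_zero, zero_add] at e₄
    exact (mul_eq_zero.1 e₄).resolve_left (star_ne_zero.2 hA)
  ext s t
  fin_cases s <;> fin_cases t <;> simp [X00, X01, X10, X11, hx, hy]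


/-! ### Labels -/

/-- The qubit state named by a label, for given parameters `p 0, p 1, …`: the labels `0` and `1`
stand for `|0⟩` and `|1⟩`, and `2 j + 2` and `2 j + 3` for `p j` and the state orthogonal to it. -/
def val (p : ℕ → Qubit) : ℕ → Qubit
  | 0 => k0
  | 1 => k1
  | l + 2 => if l % 2 = 0 then p (l / 2) else perp (p (l / 2))

/-- The label of the orthogonal state. -/
def flip (a : ℕ) : ℕ := if a % 2 = 0 then a + 1 else a - 1

theorem parallel_perp_k0 : Parallel (perp k0) k1 :=
  parallel_perp_of_braket_eq_zero (by simp [braket, k0, k1])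

theorem parallel_perp_k1 : Parallel (perp k1) k0 :=
  parallel_perp_of_braket_eq_zero (by simp [braket, k0, k1])

theorem parallel_val_flip (p : ℕ → Qubit) (a : ℕ) :
    Parallel (perp (val p a)) (val p (flip a)) := by
  match a with
  | 0 => exact parallel_perp_k0
  | 1 => exact parallel_perp_k1
  | l + 2 =>
    rcases Nat.mod_two_eq_zero_or_one l with h | h
    · have h1 : flip (l + 2) = (l + 1) + 2 := by simp only [flip]; split <;> omega
      have h2 : (l + 1) / 2 = l / 2 := by omega
      rw [h1]
      simp only [val, h, if_true, h2, if_neg (by omega : ¬ (l + 1) % 2 = 0)]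
      exact Parallel.refl _
    · obtain ⟨k, rfl⟩ : ∃ k, l = k + 1 := ⟨l - 1, by omega⟩
      have h1 : flip (k + 1 + 2) = k + 2 := by simp only [flip]; split <;> omega
      have h2 : (k + 1) / 2 = k / 2 := by omega
      rw [h1]
      simp only [val, h2, if_pos (by omega : k % 2 = 0), if_neg (by omega : ¬ (k + 1) % 2 = 0)]
      exact parallel_perp_perp _

theorem distinct_flip {p : ℕ → Qubit} {a b : ℕ} (h : Distinct (val p (flip a)) (val p (flip b))) :
    Distinct (val p a) (val p b) :=
  (h.of_parallel (parallel_val_flip p a).symm (parallel_val_flip p b).symm).perp_perp.of_parallel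
    (parallel_perp_perp _) (parallel_perp_perp _)

/-- The inequalities between labels that follow from the inequalities in the list `D` by symmetry
and by passing to the orthogonal states. -/
def known (D : List (ℕ × ℕ)) (a b : ℕ) : Bool :=
  b == flip a || D.contains (a, b) || D.contains (b, a) ||
    D.contains (flip a, flip b) || D.contains (flip b, flip a)

theorem distinct_of_known {p : ℕ → Qubit} {D : List (ℕ × ℕ)}
    (hD : ∀ d ∈ D, Distinct (val p d.1) (val p d.2)) {a b : ℕ} (h : known D a b = true) :
    Distinct (val p a) (val p b) := by
  simp only [known, Bool.or_eq_true, beq_iff_eq, List.contains_iff_mem] at h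
  rcases h with (((rfl | h) | h) | h) | h
  · exact (distinct_perp _).of_parallel (Parallel.refl _) (parallel_val_flip p a)
  · exact hD _ h
  · exact (hD _ h).symm
  · exact distinct_flip (hD _ h)
  · exact distinct_flip (hD _ h).symm

/-! ### Forms that vanish at labelled product vectors

A product vector of two qubits is given by a pair of labels. In this section `u` and `w` name the
states of the first and of the second qubit, and `e` and `f` are relations on labels that separate
the states named by `u` and by `w`. -/

/-- Labels in the relation `e` name different states. -/
def Separates (u : ℕ → Qubit) (e : ℕ → ℕ → Bool) : Prop :=
  ∀ a b, e a b = true → Distinct (u a) (u b)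

/-- The form `X` vanishes at the product vectors in the list `P`. -/
def Vanish (u w : ℕ → Qubit) (X : Form) (P : List (ℕ × ℕ)) : Prop :=
  ∀ x ∈ P, ev X (u x.1) (w x.2) = 0

/-- The product vectors in `P` with the two qubits exchanged. -/
def swapped (P : List (ℕ × ℕ)) : List (ℕ × ℕ) := P.map Prod.swap

theorem Vanish.swap {u w : ℕ → Qubit} {X : Form} {P : List (ℕ × ℕ)} (h : Vanish u w X P) :
    Vanish w u (fun s t => X t s) (swapped P) := by
  intro x hx
  obtain ⟨y, hy, rfl⟩ := List.mem_map.1 hx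
  rw [ev_swap]
  exact h y hy

theorem eq_zero_of_swap {X : Form} (h : (fun s t => X t s) = (0 : Form)) : X = 0 := by
  ext s t
  exact congrFun (congrFun h t) s

/-- `P` has two different vectors with the first qubit `a`. -/
def rowNull (f : ℕ → ℕ → Bool) (P : List (ℕ × ℕ)) (a : ℕ) : Bool :=
  P.any fun x => x.1 == a && P.any fun y => y.1 == a && f x.2 y.2

/-- Forms vanishing on `P` are orthogonal to all vectors with the first qubit `a`: two such vectors
are in `P`, or one is in `P` and another one, `|a, b⟩`, is in the span of two vectors of `P` with
the second qubit `b`. -/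
def rowNull' (e f : ℕ → ℕ → Bool) (P : List (ℕ × ℕ)) (a : ℕ) : Bool :=
  rowNull f P a ||
    P.any fun x => x.1 == a && P.any fun y => f x.2 y.2 && rowNull e (swapped P) y.2

/-- Two different states of the first qubit are null in the sense of `rowNull'`. -/
def spansHalf (e f : ℕ → ℕ → Bool) (P : List (ℕ × ℕ)) : Bool :=
  P.any fun x => rowNull' e f P x.1 && P.any fun y => e x.1 y.1 && rowNull' e f P y.1

/-- `P` contains two pairs of vectors as in `eq_zero_of_orthogonal_pairs`. -/
def spansOrth (e : ℕ → ℕ → Bool) (P : List (ℕ × ℕ)) : Bool :=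
  P.any fun i => P.any fun j => j.1 == flip i.1 && P.any fun k => k.2 == flip i.2 &&
    P.contains (flip k.1, flip j.2) && e i.1 (flip k.1)

/-- A sufficient condition for `P` to span `ℂ² ⊗ ℂ²`. -/
def spans (e f : ℕ → ℕ → Bool) (P : List (ℕ × ℕ)) : Bool :=
  spansHalf e f P || spansHalf f e (swapped P) || spansOrth e P

/-- `P` has two different vectors with a common first qubit, and a third one without it. -/
def rigidHalf (e f : ℕ → ℕ → Bool) (P : List (ℕ × ℕ)) : Bool :=
  P.any fun x => rowNull f P x.1 && P.any fun y => e x.1 y.1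

/-- `P` has three vectors that differ pairwise in both qubits. -/
def rigidGeneral (e f : ℕ → ℕ → Bool) (P : List (ℕ × ℕ)) : Bool :=
  P.any fun x => P.any fun y => e x.1 y.1 && f x.2 y.2 &&
    P.any fun z => e x.1 z.1 && e y.1 z.1 && f x.2 z.2 && f y.2 z.2

/-- A sufficient condition for `P` to contain three independent vectors, so that a form vanishing
on `P` is unique up to a scalar. -/
def rigid (e f : ℕ → ℕ → Bool) (P : List (ℕ × ℕ)) : Bool :=
  rigidHalf e f P || rigidHalf f e (swapped P) || rigidGeneral e f P

/-- A sufficient condition for `P` not to span `ℂ² ⊗ ℂ²`: it has at most three vectors, or four of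
which one is in the span of the others. -/
def deficient (e f : ℕ → ℕ → Bool) (P : List (ℕ × ℕ)) : Bool :=
  decide (P.length ≤ 3) || P.any fun x => decide ((P.erase x).length ≤ 3) &&
    (rowNull' e f (P.erase x) x.1 || rowNull' f e (swapped (P.erase x)) x.2)

section Soundness

variable {u w : ℕ → Qubit} {e f : ℕ → ℕ → Bool}

theorem isNull_of_rowNull (hf : Separates w f) {X : Form}
    {P : List (ℕ × ℕ)} (hX : Vanish u w X P) {a : ℕ} (h : rowNull f P a = true) :
    IsNull X (u a) := by
  simp only [rowNull, List.any_eq_true, Bool.and_eq_true, beq_iff_eq] at h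
  obtain ⟨x, hx, rfl, y, hy, hxy, hd⟩ := h
  exact isNull_of_distinct (hf _ _ hd) (hX x hx) (hxy ▸ hX y hy)

theorem isNull_of_rowNull' (he : Separates u e)
    (hf : Separates w f) {X : Form}
    {P : List (ℕ × ℕ)} (hX : Vanish u w X P) {a : ℕ} (h : rowNull' e f P a = true) :
    IsNull X (u a) := by
  rw [rowNull', Bool.or_eq_true] at h
  rcases h with h | h
  · exact isNull_of_rowNull hf hX h
  · simp only [List.any_eq_true, Bool.and_eq_true, beq_iff_eq] at h
    obtain ⟨x, hx, rfl, y, hy, hd, hn⟩ := h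
    have hn' := isNull_of_rowNull he hX.swap hn (u x.1)
    rw [ev_swap] at hn'
    exact isNull_of_distinct (hf _ _ hd) (hX x hx) hn'

theorem eq_zero_of_spansHalf (he : Separates u e)
    (hf : Separates w f) {X : Form}
    {P : List (ℕ × ℕ)} (hX : Vanish u w X P) (h : spansHalf e f P = true) : X = 0 := by
  simp only [spansHalf, List.any_eq_true, Bool.and_eq_true] at h
  obtain ⟨x, -, h1, y, -, hd, h2⟩ := h
  exact eq_zero_of_isNull (he _ _ hd) (isNull_of_rowNull' he hf hX h1)
    (isNull_of_rowNull' he hf hX h2)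

theorem eq_zero_of_spansOrth (he : Separates u e)
    (hu : ∀ a, Parallel (perp (u a)) (u (flip a))) (hw : ∀ a, Parallel (perp (w a)) (w (flip a)))
    {X : Form} {P : List (ℕ × ℕ)} (hX : Vanish u w X P) (h : spansOrth e P = true) : X = 0 := by
  simp only [spansOrth, List.any_eq_true, Bool.and_eq_true, beq_iff_eq,
    List.contains_iff_mem] at h
  obtain ⟨i, hi, j, hj, hij, k, hk, ⟨hik, hl⟩, hd⟩ := h
  have h2 := hX j hj
  have h3 := hX k hk
  have h4 := hX _ hl
  rw [hij] at h2
  rw [hik] at h3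
  exact eq_zero_of_orthogonal_pairs ((he _ _ hd).of_parallel (Parallel.refl _) (hu _).symm)
    (hX i hi) ((ev_parallel (hu _) (Parallel.refl _)).2 h2)
    ((ev_parallel (Parallel.refl _) (hw _)).2 h3) ((ev_parallel (hu _) (hw _)).2 h4)

theorem eq_zero_of_spans (he : Separates u e)
    (hf : Separates w f)
    (hu : ∀ a, Parallel (perp (u a)) (u (flip a))) (hw : ∀ a, Parallel (perp (w a)) (w (flip a)))
    {X : Form} {P : List (ℕ × ℕ)} (hX : Vanish u w X P) (h : spans e f P = true) : X = 0 := by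
  simp only [spans, Bool.or_eq_true] at h
  rcases h with (h | h) | h
  · exact eq_zero_of_spansHalf he hf hX h
  · exact eq_zero_of_swap (eq_zero_of_spansHalf hf he hX.swap h)
  · exact eq_zero_of_spansOrth he hu hw hX h

theorem eq_smul_of_rigidHalf (he : Separates u e)
    (hf : Separates w f) {X Y : Form} {P : List (ℕ × ℕ)}
    (hX : Vanish u w X P) (hY : Vanish u w Y P) (hY0 : Y ≠ 0) (h : rigidHalf e f P = true) :
    ∃ c : ℂ, X = c • Y := by
  simp only [rigidHalf, List.any_eq_true, Bool.and_eq_true] at h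
  obtain ⟨x, -, hn, y, hy, hd⟩ := h
  have hXn := isNull_of_rowNull hf hX hn
  have hYn := isNull_of_rowNull hf hY hn
  -- normalise at a fourth product vector that completes the vectors of `P` to a basis
  have hne : ev Y (u y.1) (perp (w y.2)) ≠ 0 := fun h0 =>
    hY0 (eq_zero_of_isNull (he _ _ hd) hYn (isNull_of_distinct (distinct_perp _) (hY y hy) h0))
  refine ⟨ev X (u y.1) (perp (w y.2)) / ev Y (u y.1) (perp (w y.2)), sub_eq_zero.1 ?_⟩
  refine eq_zero_of_isNull (he _ _ hd) (fun b => ?_)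
    (isNull_of_distinct (distinct_perp (w y.2)) ?_ ?_)
  · rw [ev_sub_smul, hXn b, hYn b, mul_zero, sub_zero]
  · rw [ev_sub_smul, hX y hy, hY y hy, mul_zero, sub_zero]
  · rw [ev_sub_smul, div_mul_cancel₀ _ hne, sub_self]

/-- A form that vanishes at three product vectors in general position and at `|a, b⟩`, where `a` and
`b` are taken from two of them, is zero. -/
theorem eq_zero_of_general (he : Separates u e)
    (hf : Separates w f) {X : Form} {x y z : ℕ × ℕ}
    (hx : ev X (u x.1) (w x.2) = 0) (hy : ev X (u y.1) (w y.2) = 0)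
    (hz : ev X (u z.1) (w z.2) = 0) (hxy : ev X (u x.1) (w y.2) = 0)
    (e1 : e x.1 y.1 = true) (f1 : f x.2 y.2 = true) (e2 : e x.1 z.1 = true)
    (f3 : f y.2 z.2 = true) : X = 0 := by
  have hn := isNull_of_distinct (hf _ _ f1) hx hxy
  refine eq_zero_of_swap (eq_zero_of_isNull (hf _ _ f3) (isNull_of_distinct (he _ _ e1) ?_ ?_)
    (isNull_of_distinct (he _ _ e2) ?_ ?_)) <;> rw [ev_swap]
  exacts [hn _, hy, hn _, hz]

theorem eq_smul_of_rigidGeneral (he : Separates u e)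
    (hf : Separates w f) {X Y : Form} {P : List (ℕ × ℕ)}
    (hX : Vanish u w X P) (hY : Vanish u w Y P) (hY0 : Y ≠ 0)
    (h : rigidGeneral e f P = true) : ∃ c : ℂ, X = c • Y := by
  simp only [rigidGeneral, List.any_eq_true, Bool.and_eq_true] at h
  obtain ⟨x, hx, y, hy, ⟨e1, f1⟩, z, hz, ⟨⟨e2, -⟩, -⟩, f3⟩ := h
  have hne : ev Y (u x.1) (w y.2) ≠ 0 := fun h0 =>
    hY0 (eq_zero_of_general he hf (x := x) (y := y) (z := z) (hY x hx) (hY y hy) (hY z hz) h0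
      e1 f1 e2 f3)
  refine ⟨ev X (u x.1) (w y.2) / ev Y (u x.1) (w y.2), sub_eq_zero.1 ?_⟩
  refine eq_zero_of_general he hf (x := x) (y := y) (z := z) ?_ ?_ ?_ ?_ e1 f1 e2 f3
  · rw [ev_sub_smul, hX x hx, hY x hx, mul_zero, sub_zero]
  · rw [ev_sub_smul, hX y hy, hY y hy, mul_zero, sub_zero]
  · rw [ev_sub_smul, hX z hz, hY z hz, mul_zero, sub_zero]
  · rw [ev_sub_smul, div_mul_cancel₀ _ hne, sub_self]

theorem eq_smul_of_rigid (he : Separates u e)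
    (hf : Separates w f) {X Y : Form} {P : List (ℕ × ℕ)}
    (hX : Vanish u w X P) (hY : Vanish u w Y P) (hY0 : Y ≠ 0) (h : rigid e f P = true) :
    ∃ c : ℂ, X = c • Y := by
  simp only [rigid, Bool.or_eq_true] at h
  rcases h with (h | h) | h
  · exact eq_smul_of_rigidHalf he hf hX hY hY0 h
  · obtain ⟨c, hc⟩ := eq_smul_of_rigidHalf hf he hX.swap hY.swap
      (fun h0 => hY0 (eq_zero_of_swap h0)) h
    exact ⟨c, by ext s t; exact congrFun (congrFun hc t) s⟩
  · exact eq_smul_of_rigidGeneral he hf hX hY hY0 h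

/-- Three linear conditions on `ℂ² ⊗ ℂ²` have a nonzero solution. -/
theorem exists_vanish_of_length_le (u w : ℕ → Qubit) {P : List (ℕ × ℕ)} (h : P.length ≤ 3) :
    ∃ X : Form, X ≠ 0 ∧ Vanish u w X P := by
  let φ : Form →ₗ[ℂ] (Fin P.length → ℂ) :=
    { toFun := fun X i => ev X (u (P.get i).1) (w (P.get i).2)
      map_add' := fun X Y => by ext i; simp only [ev_eq, Pi.add_apply]; ring
      map_smul' := fun c X => by
        ext i; simp only [ev_eq, Pi.smul_apply, smul_eq_mul, RingHom.id_apply]; ring }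
  have hlt : Module.finrank ℂ (Fin P.length → ℂ) < Module.finrank ℂ Form := by
    have h4 : Module.finrank ℂ Form = 4 := by
      rw [Module.finrank_pi_fintype]; simp
    rw [h4, Module.finrank_fin_fun]
    omega
  obtain ⟨X, hX, hX0⟩ := Submodule.exists_mem_ne_zero_of_ne_bot
    (LinearMap.ker_ne_bot_of_finrank_lt (f := φ) hlt)
  refine ⟨X, hX0, fun x hx => ?_⟩
  obtain ⟨i, rfl⟩ := List.get_of_mem hx
  exact congrFun hX i

theorem exists_vanish_of_deficient (he : Separates u e)
    (hf : Separates w f) {P : List (ℕ × ℕ)}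
    (h : deficient e f P = true) : ∃ X : Form, X ≠ 0 ∧ Vanish u w X P := by
  simp only [deficient, Bool.or_eq_true, List.any_eq_true, Bool.and_eq_true,
    decide_eq_true_eq] at h
  rcases h with h | ⟨x, -, hl, hn⟩
  · exact exists_vanish_of_length_le u w h
  · obtain ⟨X, hX0, hX⟩ := exists_vanish_of_length_le u w hl
    refine ⟨X, hX0, fun y hy => ?_⟩
    by_cases hyx : y = x
    · subst hyx
      rcases hn with hn | hn
      · exact isNull_of_rowNull' he hf hX hn _
      · rw [← ev_swap]
        exact isNull_of_rowNull' hf he hX.swap hn _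
    · exact hX y ((List.mem_erase_of_ne hyx).2 hy)

end Soundness


/-! ### Product vectors of the four-qubit system -/

/-- The vector `X ⊗ Y`, where `X` belongs to the first two and `Y` to the last two qubits. -/
def prodVec (X Y : Form) : Idx → ℂ := fun x => X (x 0) (x 1) * Y (x 2) (x 3)

theorem isProductVector_g44_iff {v : Idx → ℂ} :
    IsProductVector g44 v ↔ v ≠ 0 ∧ ∃ X Y : Form, v = prodVec X Y := by
  refine and_congr_right fun _ => ⟨?_, ?_⟩
  · rintro ⟨φ, hφ⟩
    refine ⟨fun a b => φ 0 fun s => ![a, b, a, b] s.1, fun c d => φ 1 fun s => ![c, d, c, d] s.1,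
      funext fun x => ?_⟩
    rw [hφ x, Fin.prod_univ_two, prodVec]
    congr 2 <;> funext ⟨s, hs⟩ <;> fin_cases s <;> simp [g44] at hs ⊢
  · rintro ⟨X, Y, rfl⟩
    refine ⟨fun p => match p with
      | 0 => fun y => X (y ⟨0, rfl⟩) (y ⟨1, rfl⟩)
      | 1 => fun y => Y (y ⟨2, rfl⟩) (y ⟨3, rfl⟩), fun x => ?_⟩
    rw [Fin.prod_univ_two]
    rfl

theorem IsProductVector.g44_of_g2222 {v : Idx → ℂ} (h : IsProductVector g2222 v) :
    IsProductVector g44 v := by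
  obtain ⟨h0, φ, hφ⟩ := h
  refine isProductVector_g44_iff.2 ⟨h0, fun a b => φ 0 (fun _ => a) * φ 1 (fun _ => b),
    fun c d => φ 2 (fun _ => c) * φ 3 (fun _ => d), funext fun x => ?_⟩
  have key : ∀ p : Fin 4, φ p (fun s => x s.1) = φ p (fun _ => x p) := fun p =>
    congrArg _ (funext fun s => congrArg x s.2)
  rw [hφ x, Fin.prod_univ_four, key, key, key, key, prodVec]
  ring

theorem IsProductVector.g44_of_g224 {v : Idx → ℂ} (h : IsProductVector g224 v) :
    IsProductVector g44 v := by
  obtain ⟨h0, φ, hφ⟩ := h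
  refine isProductVector_g44_iff.2 ⟨h0, fun a b => φ 0 (fun _ => a) * φ 1 (fun _ => b),
    fun c d => φ 2 fun s => ![c, d, c, d] s.1, funext fun x => ?_⟩
  rw [hφ x, Fin.prod_univ_three, prodVec]
  congr 3 <;> funext ⟨s, hs⟩ <;> fin_cases s <;> simp [g224] at hs ⊢

theorem sum_idx (f : Idx → ℂ) : ∑ x, f x = ∑ a, ∑ b, ∑ c, ∑ d, f ![a, b, c, d] := by
  let E : Fin 2 × Fin 2 × Fin 2 × Fin 2 ≃ Idx :=
    { toFun := fun y => ![y.1, y.2.1, y.2.2.1, y.2.2.2]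
      invFun := fun x => (x 0, x 1, x 2, x 3)
      left_inv := fun _ => rfl
      right_inv := fun x => by ext s; fin_cases s <;> rfl }
  rw [← Fintype.sum_equiv E _ f fun _ => rfl]
  simp only [Fintype.sum_prod_type]
  rfl

theorem star_ket_dotProduct_prodVec (r : Fin 4 → Qubit) (X Y : Form) :
    star (ket r) ⬝ᵥ prodVec X Y = ev X (r 0) (r 1) * ev Y (r 2) (r 3) := by
  have h : ∀ a b c d : Fin 2, star (ket r) ![a, b, c, d] * prodVec X Y ![a, b, c, d] =
      (star ((r 0).1 a) * star ((r 1).1 b) * X a b) *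
        (star ((r 2).1 c) * star ((r 3).1 d) * Y c d) := by
    intro a b c d
    simp only [ket, prodVec, Pi.star_apply, Fin.prod_univ_four, star_mul']
    simp
    ring
  rw [dotProduct, sum_idx]
  simp only [h, ← Finset.mul_sum, ← Finset.sum_mul]
  rfl

/-- The product vector `|a, b⟩` of two qubits. -/
def tensor (a b : Qubit) : Form := fun s t => a.1 s * b.1 t

theorem ev_tensor (a b a' b' : Qubit) : ev (tensor a b) a' b' = braket a' a * braket b' b := by
  simp only [ev_eq, tensor, braket]; ring

theorem ket_eq_prodVec (r : Fin 4 → Qubit) :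
    ket r = prodVec (tensor (r 0) (r 1)) (tensor (r 2) (r 3)) := by
  funext x
  simp only [ket, prodVec, tensor, Fin.prod_univ_four]; ring

theorem star_ket_dotProduct_ket (r r' : Fin 4 → Qubit) :
    star (ket r) ⬝ᵥ ket r' = ∏ s, braket (r s) (r' s) := by
  rw [ket_eq_prodVec r', star_ket_dotProduct_prodVec, ev_tensor, ev_tensor, Fin.prod_univ_four]
  ring

/-- Any two rows are orthogonal in one of the four qubits. -/
def OrthogonalRows {n : ℕ} (F : Fin n → Fin 4 → Qubit) : Prop :=
  ∀ i j, i ≠ j → ∃ s, braket (F i s) (F j s) = 0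

theorem OrthogonalRows.orthonormal {n : ℕ} {F : Fin n → Fin 4 → Qubit} (h : OrthogonalRows F)
    (i j : Fin n) : star (ket (F i)) ⬝ᵥ ket (F j) = if i = j then 1 else 0 := by
  rw [star_ket_dotProduct_ket]
  split_ifs with hij
  · subst hij
    exact Finset.prod_eq_one fun s _ => braket_self _
  · obtain ⟨s, hs⟩ := h i j hij
    exact Finset.prod_eq_zero (Finset.mem_univ s) hs

/-! ### The projection onto the complement of an orthonormal family -/

section Complement

variable {n : ℕ} {ψ : Fin n → Idx → ℂ}

open Matrix

/-- The projection onto the orthogonal complement of the family `ψ`, when `ψ` is orthonormal. -/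
def complement (ψ : Fin n → Idx → ℂ) : Matrix Idx Idx ℂ := 1 - ∑ i, proj (ψ i)

theorem sum_proj_eq (ψ : Fin n → Idx → ℂ) : ∑ i, proj (ψ i) = (of ψ)ᵀ * (of ψ)ᵀᴴ := by
  ext x y
  simp [Matrix.sum_apply, proj, vecMulVec_apply, mul_apply, conjTranspose_apply]

theorem conjTranspose_mul_self_of_orthonormal
    (h : ∀ i j, star (ψ i) ⬝ᵥ ψ j = if i = j then 1 else 0) :
    (of ψ)ᵀᴴ * (of ψ)ᵀ = 1 := by
  ext i j
  rw [one_apply, ← h i j]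
  simp [mul_apply, conjTranspose_apply, dotProduct]

theorem conjTranspose_mulVec (ψ : Fin n → Idx → ℂ) (v : Idx → ℂ) (i : Fin n) :
    ((of ψ)ᵀᴴ *ᵥ v) i = star (ψ i) ⬝ᵥ v := by
  simp [mulVec, dotProduct, conjTranspose_apply]

theorem posSemidef_complement (h : ∀ i j, star (ψ i) ⬝ᵥ ψ j = if i = j then 1 else 0) :
    (complement ψ).PosSemidef := by
  have h1 := conjTranspose_mul_self_of_orthonormal h
  have h2 : (complement ψ)ᴴ * complement ψ = complement ψ := by
    rw [complement, sum_proj_eq]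
    generalize (of ψ)ᵀ = V at *
    have h3 : V * Vᴴ * (V * Vᴴ) = V * Vᴴ := by
      rw [Matrix.mul_assoc, ← Matrix.mul_assoc Vᴴ, h1, Matrix.one_mul]
    rw [conjTranspose_sub, conjTranspose_one, conjTranspose_mul, conjTranspose_conjTranspose,
      Matrix.sub_mul, Matrix.mul_sub, Matrix.mul_sub, h3]
    simp
  rw [← h2]
  exact posSemidef_conjTranspose_mul_self _

/-- The range of the projection is the orthogonal complement of the family. -/
theorem mem_range_complement (h : ∀ i j, star (ψ i) ⬝ᵥ ψ j = if i = j then 1 else 0) {c : ℂ}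
    (hc : c ≠ 0) (v : Idx → ℂ) :
    v ∈ LinearMap.range (c • complement ψ).mulVecLin ↔ ∀ i, star (ψ i) ⬝ᵥ v = 0 := by
  have h1 := conjTranspose_mul_self_of_orthonormal h
  have h2 : (∀ i, star (ψ i) ⬝ᵥ v = 0) ↔ (of ψ)ᵀᴴ *ᵥ v = 0 := by
    simp only [funext_iff, conjTranspose_mulVec, Pi.zero_apply]
  rw [h2]
  simp only [complement, sum_proj_eq, LinearMap.mem_range, mulVecLin_apply]
  generalize (of ψ)ᵀ = V at *
  constructor
  · rintro ⟨w, rfl⟩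
    rw [mulVec_mulVec, Matrix.mul_smul, Matrix.mul_sub, ← Matrix.mul_assoc, h1]
    simp
  · intro hv
    refine ⟨c⁻¹ • v, ?_⟩
    rw [smul_mulVec, mulVec_smul, smul_smul, mul_inv_cancel₀ hc, one_smul, sub_mulVec, one_mulVec,
      ← mulVec_mulVec, hv, mulVec_zero, sub_zero]

theorem rank_complement (h : ∀ i j, star (ψ i) ⬝ᵥ ψ j = if i = j then 1 else 0) {c : ℂ}
    (hc : c ≠ 0) : (c • complement ψ).rank + n = 16 := by
  have h1 := conjTranspose_mul_self_of_orthonormal h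
  have h2 : LinearMap.range (c • complement ψ).mulVecLin =
      LinearMap.ker ((of ψ)ᵀᴴ).mulVecLin := by
    ext v
    rw [mem_range_complement h hc, LinearMap.mem_ker, mulVecLin_apply, funext_iff]
    simp only [conjTranspose_mulVec, Pi.zero_apply]
  have h3 : ((of ψ)ᵀᴴ).rank = n := by
    rw [rank_conjTranspose, ← rank_conjTranspose_mul_self, h1, rank_one, Fintype.card_fin]
  have h4 := LinearMap.finrank_range_add_finrank_ker ((of ψ)ᵀᴴ).mulVecLin
  rw [← h2, Module.finrank_fintype_fun_eq_card] at h4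
  simp only [Matrix.rank] at *
  rw [h3] at h4
  simp at h4
  omega

theorem trace_complement (h : ∀ i j, star (ψ i) ⬝ᵥ ψ j = if i = j then 1 else 0) :
    (complement ψ).trace = 16 - n := by
  have h1 : ∀ i, (proj (ψ i)).trace = 1 := fun i => by
    rw [proj, trace_vecMulVec, dotProduct_comm, h i i, if_pos rfl]
  rw [complement, trace_sub, trace_sum]
  simp [h1]

end Complement

/-! ### Partial transposes -/

/-- The complex conjugate of a qubit state. -/
def conjQubit (a : Qubit) : Qubit :=
  ⟨star a.1, by
    have h := a.2
    simp only [dotProduct, Fin.sum_univ_two, Pi.star_apply, star_star] at h ⊢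
    linear_combination h⟩

section PPT

variable {P : Type} [DecidableEq P] {n : ℕ}

/-- The rows `F` with the qubits of the parties in `T` conjugated. -/
def conjRows (g : Fin 4 → P) (T : Finset P) (F : Fin n → Fin 4 → Qubit) :
    Fin n → Fin 4 → Qubit :=
  fun i s => if g s ∈ T then conjQubit (F i s) else F i s

theorem OrthogonalRows.conjRows {F : Fin n → Fin 4 → Qubit} (h : OrthogonalRows F)
    (g : Fin 4 → P) (T : Finset P) : OrthogonalRows (conjRows g T F) := by
  intro i j hij
  obtain ⟨s, hs⟩ := h i j hij
  refine ⟨s, ?_⟩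
  by_cases hT : g s ∈ T
  · simp only [FourQubit.conjRows, hT, if_true]
    have := congrArg star hs
    simpa [braket, conjQubit] using this
  · simpa [FourQubit.conjRows, hT] using hs

theorem partialTranspose_proj_ket (g : Fin 4 → P) (T : Finset P) (F : Fin n → Fin 4 → Qubit)
    (i : Fin n) :
    partialTranspose g T (proj (ket (F i))) = proj (ket (conjRows g T F i)) := by
  ext x y
  simp only [partialTranspose, proj, Matrix.vecMulVec_apply, Pi.star_apply, ket, star_prod,
    ← Finset.prod_mul_distrib]
  refine Finset.prod_congr rfl fun s _ => ?_
  by_cases hT : g s ∈ T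
  · simp [conjRows, conjQubit, hT, mul_comm]
  · simp [conjRows, hT]

theorem partialTranspose_one (g : Fin 4 → P) (T : Finset P) :
    partialTranspose g T (1 : Matrix Idx Idx ℂ) = 1 := by
  ext x y
  simp only [partialTranspose, Matrix.one_apply]
  congr 1
  simp only [eq_iff_iff, funext_iff]
  refine forall_congr' fun s => ?_
  split_ifs
  exacts [eq_comm, Iff.rfl]

/-- The partial transpose conjugates some of the qubits of the rows, which stay orthonormal. -/
theorem partialTranspose_complement (g : Fin 4 → P) (T : Finset P) (c : ℂ)
    (F : Fin n → Fin 4 → Qubit) :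
    partialTranspose g T (c • complement fun i => ket (F i)) =
      c • complement fun i => ket (conjRows g T F i) := by
  ext x y
  have h1 := congrFun (congrFun (partialTranspose_one g T) x) y
  have h2 := fun i => congrFun (congrFun (partialTranspose_proj_ket g T F i) x) y
  simp only [partialTranspose] at *
  simp only [complement, Matrix.smul_apply, Matrix.sub_apply, Matrix.sum_apply, h1, h2]

theorem isPPT_complement {F : Fin n → Fin 4 → Qubit} (h : OrthogonalRows F) (g : Fin 4 → P)
    {c : ℂ} (hc : 0 ≤ c) : IsPPT g (c • complement fun i => ket (F i)) := fun T => by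
  rw [partialTranspose_complement]
  exact (posSemidef_complement (h.conjRows g T).orthonormal).smul hc

end PPT

/-! ### The range criterion -/

section Entangled

variable {n : ℕ} {ψ : Fin n → Idx → ℂ}

theorem proj_mulVec (v w : Idx → ℂ) : (proj v).mulVec w = (star v ⬝ᵥ w) • v := by
  rw [proj, Matrix.vecMulVec_mulVec]
  ext; simp [mul_comm]

/-- The product vectors of a decomposition of a separable state lie in its range. -/
theorem mem_range_of_sum_proj (h : ∀ i j, star (ψ i) ⬝ᵥ ψ j = if i = j then 1 else 0)
    {c : ℂ} (hc : c ≠ 0) {m : ℕ} {q : Fin m → ℝ} {v : Fin m → Idx → ℂ} (hq : ∀ k, 0 ≤ q k)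
    (hρ : c • complement ψ = ∑ k, (q k : ℂ) • proj (v k)) {k : Fin m} (hk : q k ≠ 0) :
    v k ∈ LinearMap.range (c • complement ψ).mulVecLin := by
  rw [mem_range_complement h hc]
  intro i
  have h0 : star (ψ i) ⬝ᵥ (c • complement ψ).mulVec (ψ i) = 0 :=
    (mem_range_complement h hc _).1 ⟨ψ i, rfl⟩ i
  have h1 : ∀ k, star (ψ i) ⬝ᵥ ((q k : ℂ) • proj (v k)).mulVec (ψ i) =
      ((q k * Complex.normSq (star (ψ i) ⬝ᵥ v k) : ℝ) : ℂ) := fun k => by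
    have hs : star (v k) ⬝ᵥ ψ i = star (star (ψ i) ⬝ᵥ v k) := by
      rw [Matrix.star_dotProduct]
    rw [Matrix.smul_mulVec, proj_mulVec, dotProduct_smul, dotProduct_smul, hs, smul_eq_mul,
      smul_eq_mul, Complex.ofReal_mul, Complex.normSq_eq_conj_mul_self]
    rfl
  rw [hρ, Matrix.sum_mulVec, dotProduct_sum, Finset.sum_congr rfl fun k _ => h1 k,
    ← Complex.ofReal_sum, Complex.ofReal_eq_zero,
    Finset.sum_eq_zero_iff_of_nonneg fun k _ => mul_nonneg (hq k) (Complex.normSq_nonneg _)] at h0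
  exact Complex.normSq_eq_zero.1 ((mul_eq_zero.1 (h0 k (Finset.mem_univ k))).resolve_left hk)

/-- The range of a separable state is spanned by product vectors, so it contains at least as many
product vectors as its rank. -/
theorem not_isSeparable_complement {P : Type} [Fintype P] [DecidableEq P] {g : Fin 4 → P}
    (hg : ∀ v, IsProductVector g v → IsProductVector g44 v)
    (h : ∀ i j, star (ψ i) ⬝ᵥ ψ j = if i = j then 1 else 0) {c : ℂ} (hc : c ≠ 0)
    (hfin : (productRaysInRange (c • complement ψ)).Finite)
    (hcard : (productRaysInRange (c • complement ψ)).ncard < (c • complement ψ).rank) :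
    ¬ IsSeparable g (c • complement ψ) := by
  rintro ⟨m, q, v, hq, -, hv, hρ⟩
  set ρ := c • complement ψ with hρdef
  let R : Set (Idx → ℂ) := Projectivization.rep '' productRaysInRange ρ
  have hR : R.Finite := hfin.image _
  have hle : LinearMap.range ρ.mulVecLin ≤ Submodule.span ℂ R := by
    rintro _ ⟨w, rfl⟩
    rw [Matrix.mulVecLin_apply, hρ, Matrix.sum_mulVec]
    refine Submodule.sum_mem _ fun k _ => ?_
    rw [Matrix.smul_mulVec, proj_mulVec]
    by_cases hk : q k = 0
    · simp [hk]
    · have hmem := mem_range_of_sum_proj h hc hq hρ hk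
      have h0 := (hv k).1.1
      have hray : Projectivization.mk ℂ (v k) h0 ∈ productRaysInRange ρ :=
        ⟨v k, h0, hg _ (hv k).1, hmem, rfl⟩
      obtain ⟨a, ha⟩ := Projectivization.exists_smul_eq_mk_rep ℂ (v k) h0
      have hvk : v k = (a⁻¹ : ℂˣ) • (Projectivization.mk ℂ (v k) h0).rep := by
        rw [← ha, inv_smul_smul]
      refine Submodule.smul_mem _ _ (Submodule.smul_mem _ _ ?_)
      rw [hvk]
      exact Submodule.smul_mem _ ((a⁻¹ : ℂˣ) : ℂ) (Submodule.subset_span ⟨_, hray, rfl⟩)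
  have h1 : ρ.rank ≤ Module.finrank ℂ (Submodule.span ℂ R) := Submodule.finrank_mono hle
  have h2 : Module.finrank ℂ (Submodule.span ℂ R) ≤ R.ncard := by
    have := finrank_span_finset_le_card (R := ℂ) hR.toFinset
    rwa [hR.coe_toFinset, ← Set.ncard_eq_toFinset_card R hR] at this
  have h3 : R.ncard ≤ (productRaysInRange ρ).ncard := Set.ncard_image_le hfin
  omega

theorem isPPTEntangledInAllSenses_complement {F : Fin n → Fin 4 → Qubit} (h : OrthogonalRows F)
    {c : ℂ} (hc : 0 < c) (hcn : c * (16 - n) = 1)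
    (hfin : (productRaysInRange (c • complement fun i => ket (F i))).Finite)
    (hcard : (productRaysInRange (c • complement fun i => ket (F i))).ncard + n < 16) :
    IsPPTEntangledInAllSenses (c • complement fun i => ket (F i)) := by
  have ho := h.orthonormal
  have hrank := rank_complement ho hc.ne'
  have hstate : IsState (c • complement fun i => ket (F i)) :=
    ⟨(posSemidef_complement ho).smul hc.le, by
      rw [Matrix.trace_smul, trace_complement ho, smul_eq_mul, hcn]⟩
  have hlt : (productRaysInRange (c • complement fun i => ket (F i))).ncard <
      (c • complement fun i => ket (F i)).rank := by omega
  exact ⟨⟨hstate, isPPT_complement h _ hc.le,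
      not_isSeparable_complement (fun _ => IsProductVector.g44_of_g2222) ho hc.ne' hfin hlt⟩,
    ⟨hstate, isPPT_complement h _ hc.le,
      not_isSeparable_complement (fun _ => IsProductVector.g44_of_g224) ho hc.ne' hfin hlt⟩,
    ⟨hstate, isPPT_complement h _ hc.le,
      not_isSeparable_complement (fun _ => id) ho hc.ne' hfin hlt⟩⟩

end Entangled


/-! ### Counting the product vectors orthogonal to all rows -/

theorem prodVec_ne_zero_iff {X Y : Form} : prodVec X Y ≠ 0 ↔ X ≠ 0 ∧ Y ≠ 0 := by
  constructor
  · intro h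
    constructor <;> rintro rfl <;> exact h (funext fun x => by simp [prodVec])
  · rintro ⟨hX, hY⟩ h
    apply hX
    ext s t
    by_contra hst
    apply hY
    ext c d
    have := congrFun h ![s, t, c, d]
    exact (mul_eq_zero.1 this).resolve_left hst

theorem prodVec_smul (X Y : Form) (c d : ℂ) :
    prodVec (c • X) (d • Y) = (c * d) • prodVec X Y := by
  funext x
  simp only [prodVec, Pi.smul_apply, smul_eq_mul]; ring

theorem eq_smul_of_prodVec_eq {X Y X' Y' : Form} {a : ℂ} (hX : X ≠ 0) (hY : Y ≠ 0)
    (h : prodVec X Y = a • prodVec X' Y') : (∃ c : ℂ, X = c • X') ∧ ∃ c : ℂ, Y = c • Y' := by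
  obtain ⟨s, hs⟩ := Function.ne_iff.1 hX
  obtain ⟨t, hst⟩ := Function.ne_iff.1 hs
  obtain ⟨c, hc⟩ := Function.ne_iff.1 hY
  obtain ⟨d, hcd⟩ := Function.ne_iff.1 hc
  simp only [Pi.zero_apply] at hst hcd
  have key : ∀ s t c d, X s t * Y c d = a * (X' s t * Y' c d) := fun s t c d =>
    congrFun h ![s, t, c, d]
  refine ⟨⟨a * Y' c d / Y c d, ?_⟩, ⟨a * X' s t / X s t, ?_⟩⟩
  · ext i j
    rw [Pi.smul_apply, Pi.smul_apply, smul_eq_mul, div_mul_eq_mul_div, eq_div_iff hcd, key]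
    ring
  · ext i j
    rw [Pi.smul_apply, Pi.smul_apply, smul_eq_mul, div_mul_eq_mul_div, eq_div_iff hst, mul_comm,
      key]
    ring

/-- What is known about the coincidences in an `n × 4` array of qubit states: the label of each
entry, and for each column a list of pairs of labels that name different states. -/
structure Pattern (n : ℕ) where
  /-- The labels of the entries. -/
  lab : Matrix (Fin n) (Fin 4) ℕ
  /-- Pairs of labels of different states, for each column. -/
  ne : Fin 4 → List (ℕ × ℕ)

namespace Pattern

variable {n : ℕ} (p : Pattern n)

/-- The array `F` has the pattern `p` for the parameters `q s` of the columns `s`. -/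
structure Realizes (q : Fin 4 → ℕ → Qubit) (F : Fin n → Fin 4 → Qubit) : Prop where
  parallel : ∀ i s, Parallel (val (q s) (p.lab i s)) (F i s)
  distinct : ∀ s, ∀ d ∈ p.ne s, Distinct (val (q s) d.1) (val (q s) d.2)

/-- The relation on the labels of column `s` generated by the known inequalities. -/
def rel (s : Fin 4) : ℕ → ℕ → Bool := known (p.ne s)

/-- The labels of the rows in `I` in the columns `s` and `t`. -/
def points (s t : Fin 4) (I : List (Fin n)) : List (ℕ × ℕ) := I.map fun i => (p.lab i s, p.lab i t)

/-- The rows that are not in `I`. -/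
def compl (I : List (Fin n)) : List (Fin n) := (List.finRange n).filter fun i => !I.contains i

/-- Any two rows have orthogonal labels in some column. -/
def orthogonal : Bool :=
  (List.finRange n).all fun i => (List.finRange n).all fun j => i == j ||
    (List.finRange 4).any fun s => p.lab j s == flip (p.lab i s)

/-- A sufficient condition that no product vector `X ⊗ Y` is orthogonal to all rows such that `X` is
orthogonal to exactly the rows in `I`: the rows in `I` span the space of the qubits `AB`, or the
other rows span the space of `CD`, or `X` is orthogonal to another row as well. -/
def refutes (I : List (Fin n)) : Bool :=
  spans (p.rel 0) (p.rel 1) (p.points 0 1 I) ||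
    spans (p.rel 2) (p.rel 3) (p.points 2 3 (compl I)) ||
    (compl I).any fun i => rowNull' (p.rel 0) (p.rel 1) (p.points 0 1 I) (p.lab i 0) ||
      rowNull' (p.rel 1) (p.rel 0) (swapped (p.points 0 1 I)) (p.lab i 1)

/-- A certificate that the sets in `l` are the only possible sets of rows orthogonal to `X`, for
product vectors `X ⊗ Y` orthogonal to all rows, and that each of them determines `X` and `Y` up to
a scalar. -/
def boundedBy (l : List (List (Fin n))) : Bool :=
  (List.finRange n).sublists.all fun I =>
    (l.contains I && rigid (p.rel 0) (p.rel 1) (p.points 0 1 I) &&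
      rigid (p.rel 2) (p.rel 3) (p.points 2 3 (compl I))) || p.refutes I

/-- A certificate that for each set of rows in `l` there are nonzero `X` orthogonal to its rows and
`Y` orthogonal to the other rows. -/
def admits (l : List (List (Fin n))) : Bool :=
  l.all fun I => deficient (p.rel 0) (p.rel 1) (p.points 0 1 I) &&
    deficient (p.rel 2) (p.rel 3) (p.points 2 3 (compl I))

/-- A certificate that different sets of rows in `l` belong to different product vectors. -/
def separated (l : List (List (Fin n))) : Bool :=
  decide (l.Pairwise fun I J => (spans (p.rel 0) (p.rel 1) (p.points 0 1 (I ++ J)) ||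
    spans (p.rel 2) (p.rel 3) (p.points 2 3 (compl I ++ compl J))) = true)

variable {p} {q : Fin 4 → ℕ → Qubit} {F : Fin n → Fin 4 → Qubit}

theorem Realizes.separates (h : p.Realizes q F) (s : Fin 4) :
    Separates (val (q s)) (p.rel s) :=
  fun _ _ => distinct_of_known (h.distinct s)

theorem Realizes.orthogonalRows (h : p.Realizes q F) (hp : p.orthogonal = true) :
    OrthogonalRows F := by
  intro i j hij
  simp only [orthogonal, List.all_eq_true, List.mem_finRange, forall_const, Bool.or_eq_true,
    beq_iff_eq, List.any_eq_true, true_and] at hp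
  obtain ⟨s, hs⟩ := (hp i j).resolve_left hij
  refine ⟨s, braket_eq_zero_of_parallel (braket_perp_right _) (h.parallel i s) ?_⟩
  exact (parallel_val_flip _ _).trans (hs ▸ h.parallel j s)

theorem Realizes.ev_eq_zero_iff (h : p.Realizes q F) (X : Form) (s t : Fin 4) (i : Fin n) :
    ev X (F i s) (F i t) = 0 ↔ ev X (val (q s) (p.lab i s)) (val (q t) (p.lab i t)) = 0 :=
  (ev_parallel (h.parallel i s) (h.parallel i t)).symm

theorem Realizes.vanish_points (h : p.Realizes q F) {X : Form} {s t : Fin 4}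
    {I : List (Fin n)} :
    Vanish (val (q s)) (val (q t)) X (p.points s t I) ↔ ∀ i ∈ I, ev X (F i s) (F i t) = 0 := by
  simp only [Vanish, points, List.forall_mem_map, h.ev_eq_zero_iff]

theorem mem_compl {I : List (Fin n)} {i : Fin n} : i ∈ compl I ↔ i ∉ I := by
  simp [compl]

/-- The rows orthogonal to `X` in the first two qubits. -/
noncomputable def zeroSet (F : Fin n → Fin 4 → Qubit) (X : Form) : List (Fin n) :=
  open scoped Classical in (List.finRange n).filter fun i => decide (ev X (F i 0) (F i 1) = 0)

theorem mem_zeroSet {X : Form} {i : Fin n} : i ∈ zeroSet F X ↔ ev X (F i 0) (F i 1) = 0 := by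
  simp [zeroSet]

/-- `X ⊗ Y` is orthogonal to all rows. -/
def Annihilates (F : Fin n → Fin 4 → Qubit) (X Y : Form) : Prop :=
  ∀ i, ev X (F i 0) (F i 1) = 0 ∨ ev Y (F i 2) (F i 3) = 0

theorem Realizes.refutes_eq_false (h : p.Realizes q F) {X Y : Form} (hX : X ≠ 0) (hY : Y ≠ 0)
    (ha : Annihilates F X Y) : p.refutes (zeroSet F X) = false := by
  have hX' : Vanish (val (q 0)) (val (q 1)) X (p.points 0 1 (zeroSet F X)) :=
    h.vanish_points.2 fun i hi => mem_zeroSet.1 hi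
  have hY' : Vanish (val (q 2)) (val (q 3)) Y (p.points 2 3 (compl (zeroSet F X))) :=
    h.vanish_points.2 fun i hi =>
      (ha i).resolve_left fun h0 => mem_compl.1 hi (mem_zeroSet.2 h0)
  have s0 := h.separates 0
  have s1 := h.separates 1
  refine Bool.eq_false_iff.2 fun hr => ?_
  simp only [refutes, Bool.or_eq_true, List.any_eq_true] at hr
  rcases hr with (hr | hr) | ⟨i, hi, hr⟩
  · exact hX (eq_zero_of_spans s0 s1 (parallel_val_flip _) (parallel_val_flip _) hX' hr)
  · exact hY (eq_zero_of_spans (h.separates 2) (h.separates 3) (parallel_val_flip _)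
      (parallel_val_flip _) hY' hr)
  · apply mem_compl.1 hi
    rw [mem_zeroSet, h.ev_eq_zero_iff]
    rcases hr with hr | hr
    · exact isNull_of_rowNull' s0 s1 hX' hr _
    · rw [← ev_swap]
      exact isNull_of_rowNull' s1 s0 hX'.swap hr _

theorem Realizes.zeroSet_mem (h : p.Realizes q F) {l : List (List (Fin n))}
    (hl : p.boundedBy l = true) {X Y : Form} (hX : X ≠ 0) (hY : Y ≠ 0)
    (ha : Annihilates F X Y) : zeroSet F X ∈ l ∧
      rigid (p.rel 0) (p.rel 1) (p.points 0 1 (zeroSet F X)) = true ∧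
      rigid (p.rel 2) (p.rel 3) (p.points 2 3 (compl (zeroSet F X))) = true := by
  have h1 := List.all_eq_true.1 hl (zeroSet F X)
    (List.mem_sublists.2 List.filter_sublist)
  rw [h.refutes_eq_false hX hY ha, Bool.or_false, Bool.and_eq_true, Bool.and_eq_true,
    List.contains_iff_mem] at h1
  exact ⟨h1.1.1, h1.1.2, h1.2⟩

theorem Realizes.eq_smul_of_zeroSet_eq (h : p.Realizes q F) {l : List (List (Fin n))}
    (hl : p.boundedBy l = true) {X Y X' Y' : Form} (hX : X ≠ 0) (hY : Y ≠ 0) (hX' : X' ≠ 0)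
    (hY' : Y' ≠ 0) (ha : Annihilates F X Y) (ha' : Annihilates F X' Y')
    (hz : zeroSet F X = zeroSet F X') : ∃ c : ℂ, prodVec X Y = c • prodVec X' Y' := by
  obtain ⟨-, hr, hr'⟩ := h.zeroSet_mem hl hX hY ha
  have van : ∀ {X : Form}, Vanish (val (q 0)) (val (q 1)) X (p.points 0 1 (zeroSet F X)) :=
    h.vanish_points.2 fun i hi => mem_zeroSet.1 hi
  have van' : ∀ {X Y : Form}, Annihilates F X Y →
      Vanish (val (q 2)) (val (q 3)) Y (p.points 2 3 (compl (zeroSet F X))) := fun ha =>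
    h.vanish_points.2 fun i hi =>
      (ha i).resolve_left fun h0 => mem_compl.1 hi (mem_zeroSet.2 h0)
  obtain ⟨c, rfl⟩ := eq_smul_of_rigid (h.separates 0) (h.separates 1) van (hz ▸ van) hX' hr
  obtain ⟨d, rfl⟩ := eq_smul_of_rigid (h.separates 2) (h.separates 3) (van' ha)
    (hz ▸ van' ha') hY' hr'
  exact ⟨c * d, prodVec_smul _ _ _ _⟩

theorem mem_productRaysInRange (ho : OrthogonalRows F) {c : ℂ} (hc : c ≠ 0)
    (r : Projectivization ℂ (Idx → ℂ)) :
    r ∈ productRaysInRange (c • complement fun i => ket (F i)) ↔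
      ∃ (X Y : Form) (h0 : prodVec X Y ≠ 0), Annihilates F X Y ∧
        r = Projectivization.mk ℂ (prodVec X Y) h0 := by
  have key : ∀ X Y : Form, prodVec X Y ∈
      LinearMap.range (c • complement fun i => ket (F i)).mulVecLin ↔ Annihilates F X Y := by
    intro X Y
    rw [mem_range_complement ho.orthonormal hc]
    simp only [star_ket_dotProduct_prodVec, mul_eq_zero, Annihilates]
  constructor
  · rintro ⟨v, hv, hp, hr, rfl⟩
    obtain ⟨-, X, Y, rfl⟩ := isProductVector_g44_iff.1 hp
    exact ⟨X, Y, hv, (key X Y).1 hr, rfl⟩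
  · rintro ⟨X, Y, h0, ha, rfl⟩
    exact ⟨_, h0, isProductVector_g44_iff.2 ⟨h0, X, Y, rfl⟩, (key X Y).2 ha, rfl⟩

/-- A product vector in the range is determined up to a scalar by the set of rows orthogonal to its
first factor. -/
theorem Realizes.finite_and_ncard_le (h : p.Realizes q F) (ho : p.orthogonal = true) {c : ℂ}
    (hc : c ≠ 0) {l : List (List (Fin n))} (hl : p.boundedBy l = true) :
    (productRaysInRange (c • complement fun i => ket (F i))).Finite ∧
      (productRaysInRange (c • complement fun i => ket (F i))).ncard ≤ l.length := by
  classical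
  have ho' := h.orthogonalRows ho
  choose! X Y h0 ha hr using fun r => (mem_productRaysInRange ho' hc r).1
  have hmaps : Set.MapsTo (fun r => zeroSet F (X r))
      (productRaysInRange (c • complement fun i => ket (F i)))
      (l.toFinset : Set (List (Fin n))) := by
    intro r hr'
    have hXY := prodVec_ne_zero_iff.1 (h0 r hr')
    simpa using (h.zeroSet_mem hl hXY.1 hXY.2 (ha r hr')).1
  have hinj : Set.InjOn (fun r => zeroSet F (X r))
      (productRaysInRange (c • complement fun i => ket (F i))) := by
    intro r hr₁ r' hr₂ hz
    have h₁ := prodVec_ne_zero_iff.1 (h0 r hr₁)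
    have h₂ := prodVec_ne_zero_iff.1 (h0 r' hr₂)
    obtain ⟨d, hd⟩ := h.eq_smul_of_zeroSet_eq hl h₁.1 h₁.2 h₂.1 h₂.2 (ha r hr₁) (ha r' hr₂) hz
    rw [hr r hr₁, hr r' hr₂, Projectivization.mk_eq_mk_iff']
    exact ⟨d, hd.symm⟩
  refine ⟨Set.Finite.of_injOn hmaps hinj (Finset.finite_toSet _), ?_⟩
  refine (Set.ncard_le_ncard_of_injOn _ hmaps hinj (Finset.finite_toSet _)).trans ?_
  rw [Set.ncard_coe_finset]
  exact List.toFinset_card_le l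

theorem Realizes.length_le_ncard (h : p.Realizes q F) (ho : p.orthogonal = true) {c : ℂ}
    (hc : c ≠ 0) {l : List (List (Fin n))} (hl : p.admits l = true) (hs : p.separated l = true)
    (hfin : (productRaysInRange (c • complement fun i => ket (F i))).Finite) :
    l.length ≤ (productRaysInRange (c • complement fun i => ket (F i))).ncard := by
  have ho' := h.orthogonalRows ho
  have hex : ∀ k : Fin l.length, ∃ X Y : Form, X ≠ 0 ∧ Y ≠ 0 ∧
      (∀ i ∈ l.get k, ev X (F i 0) (F i 1) = 0) ∧
      ∀ i ∈ compl (l.get k), ev Y (F i 2) (F i 3) = 0 := by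
    intro k
    have hk := List.all_eq_true.1 hl (l.get k) (List.get_mem l k)
    rw [Bool.and_eq_true] at hk
    obtain ⟨X, hX, hX'⟩ := exists_vanish_of_deficient (h.separates 0) (h.separates 1) hk.1
    obtain ⟨Y, hY, hY'⟩ := exists_vanish_of_deficient (h.separates 2) (h.separates 3) hk.2
    exact ⟨X, Y, hX, hY, h.vanish_points.1 hX', h.vanish_points.1 hY'⟩
  choose X Y hX hY vX vY using hex
  have h0 : ∀ k, prodVec (X k) (Y k) ≠ 0 := fun k => prodVec_ne_zero_iff.2 ⟨hX k, hY k⟩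
  let f : Fin l.length → Projectivization ℂ (Idx → ℂ) := fun k =>
    Projectivization.mk ℂ (prodVec (X k) (Y k)) (h0 k)
  have hne : ∀ j k, j < k → f j ≠ f k := by
    intro j k hjk hf
    obtain ⟨a, ha⟩ := (Projectivization.mk_eq_mk_iff' ..).1 hf
    obtain ⟨⟨c, hc⟩, d, hd⟩ := eq_smul_of_prodVec_eq (hX j) (hY j) ha.symm
    have hev : ∀ (c : ℂ) (X : Form) a b, ev X a b = 0 → ev (c • X) a b = 0 := by
      intro c X a b h0
      have := ev_sub_smul 0 X (-c) a b
      rw [h0, mul_zero, sub_zero, neg_smul, zero_sub, neg_neg] at this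
      rw [this]
      simp [ev_eq]
    have hp := List.pairwise_iff_get.1 (of_decide_eq_true hs) j k hjk
    rw [Bool.or_eq_true] at hp
    rcases hp with hp | hp
    · refine hX j (eq_zero_of_spans (h.separates 0) (h.separates 1) (parallel_val_flip _)
        (parallel_val_flip _) (h.vanish_points.2 fun i hi => ?_) hp)
      rcases List.mem_append.1 hi with hi | hi
      · exact vX j i hi
      · rw [hc]; exact hev _ _ _ _ (vX k i hi)
    · refine hY j (eq_zero_of_spans (h.separates 2) (h.separates 3) (parallel_val_flip _)
        (parallel_val_flip _) (h.vanish_points.2 fun i hi => ?_) hp)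
      rcases List.mem_append.1 hi with hi | hi
      · exact vY j i hi
      · rw [hd]; exact hev _ _ _ _ (vY k i hi)
  have hinj : Function.Injective f := by
    intro j k hjk
    by_contra hn
    rcases lt_or_gt_of_ne hn with hlt | hlt
    exacts [hne j k hlt hjk, hne k j hlt hjk.symm]
  have hsub : Set.range f ⊆ productRaysInRange (c • complement fun i => ket (F i)) := by
    rintro _ ⟨k, rfl⟩
    refine (mem_productRaysInRange ho' hc _).2 ⟨X k, Y k, h0 k, fun i => ?_, rfl⟩
    by_cases hi : i ∈ l.get k
    · exact Or.inl (vX k i hi)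
    · exact Or.inr (vY k i (mem_compl.2 hi))
  calc l.length = (Set.range f).ncard := by
        rw [← Set.image_univ, Set.ncard_image_of_injective _ hinj, Set.ncard_univ,
          Nat.card_eq_fintype_card, Fintype.card_fin]
    _ ≤ _ := Set.ncard_le_ncard hsub hfin

end Pattern


/-! ### The patterns of the arrays -/

/-- The parameters of the columns are the entries of the lists `l 0, …, l 3`; the value `k0`
beyond the end of a list is never used. -/
def params (l : Fin 4 → List Qubit) : Fin 4 → ℕ → Qubit := fun s j => (l s).getD j k0

/-- The pattern of all rows but the first. -/
def Pattern.tail (p : Pattern 8) : Pattern 7 := ⟨fun i => p.lab i.succ, p.ne⟩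

/-- The known inequalities in a column with one parameter, which is different from `|0⟩, |1⟩`. -/
def oneParam : List (ℕ × ℕ) := [(2, 0), (2, 1)]

/-- The known inequalities in a column with two parameters, which are different from `|0⟩, |1⟩`. -/
def twoParams : List (ℕ × ℕ) := [(2, 0), (2, 1), (4, 0), (4, 1)]

/-- The first array, with the parameters `i₃`, `i₄` in the last column. -/
def pattern1 : Pattern 8 where
  lab := !![0, 0, 0, 0;
            0, 1, 0, 1;
            1, 2, 2, 2;
            1, 3, 2, 4;
            2, 3, 1, 5;
            2, 2, 1, 3;
            3, 0, 3, 1;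
            3, 1, 3, 0]
  ne := ![oneParam, oneParam, oneParam, (2, 4) :: twoParams]

/-- The second array, with the parameters `i₂`, `i₃`, `i₄` in the last column. -/
def pattern2 : Pattern 8 where
  lab := !![0, 0, 0, 0;
            0, 1, 0, 2;
            1, 2, 2, 4;
            1, 3, 2, 6;
            2, 3, 1, 7;
            2, 2, 1, 5;
            3, 1, 3, 3;
            3, 0, 3, 1]
  ne := ![oneParam, oneParam, oneParam, (4, 6) :: (4, 7) :: oneParam]

/-- The second array with `i₃ = i₂` and `i₄ = 0`. -/
def pattern2special : Pattern 8 where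
  lab := !![0, 0, 0, 0;
            0, 1, 0, 2;
            1, 2, 2, 2;
            1, 3, 2, 0;
            2, 3, 1, 1;
            2, 2, 1, 3;
            3, 1, 3, 3;
            3, 0, 3, 1]
  ne := ![oneParam, oneParam, oneParam, oneParam]

/-- The third array, with additional inequalities `ne` in the third column. -/
def pattern3 (ne : List (ℕ × ℕ)) : Pattern 8 where
  lab := !![0, 0, 0, 0;
            0, 1, 0, 2;
            1, 2, 2, 0;
            1, 3, 4, 2;
            2, 3, 1, 3;
            2, 2, 1, 1;
            3, 1, 3, 3;
            3, 0, 5, 1]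
  ne := ![oneParam, oneParam, ne ++ (2, 4) :: twoParams, oneParam]

/-- The third array with `h₄ = h₃'`. -/
def pattern3perp : Pattern 8 where
  lab := !![0, 0, 0, 0;
            0, 1, 0, 2;
            1, 2, 2, 0;
            1, 3, 3, 2;
            2, 3, 1, 3;
            2, 2, 1, 1;
            3, 1, 3, 3;
            3, 0, 2, 1]
  ne := ![oneParam, oneParam, oneParam, oneParam]

/-- The fourth array, with the parameters `g₃`, `g₄` in the second and `i₂`, `i₃` in the last
column. -/
def pattern4 : Pattern 8 where
  lab := !![0, 0, 0, 0;
            0, 1, 0, 2;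
            1, 2, 2, 4;
            1, 4, 2, 5;
            2, 3, 1, 4;
            2, 5, 1, 5;
            3, 1, 3, 3;
            3, 0, 3, 1]
  ne := ![oneParam, (2, 4) :: (2, 5) :: twoParams, oneParam, (2, 4) :: (2, 5) :: twoParams]

/-- The fifth array, with additional inequalities `ne` in the first column. -/
def pattern5 (ne : List (ℕ × ℕ)) : Pattern 8 where
  lab := !![0, 0, 0, 0;
            0, 1, 0, 2;
            1, 2, 2, 1;
            1, 3, 2, 3;
            2, 2, 1, 0;
            4, 3, 1, 2;
            3, 1, 3, 3;
            5, 0, 3, 1]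
  ne := ![ne ++ (2, 4) :: twoParams, oneParam, oneParam, oneParam]

/-- The fifth array with `f₆ = f₅'`. -/
def pattern5perp : Pattern 8 where
  lab := !![0, 0, 0, 0;
            0, 1, 0, 2;
            1, 2, 2, 1;
            1, 3, 2, 3;
            2, 2, 1, 0;
            3, 3, 1, 2;
            3, 1, 3, 3;
            2, 0, 3, 1]
  ne := ![oneParam, oneParam, oneParam, oneParam]

/-- The sixth array, with the inequalities common to both alternatives for its last column. -/
def pattern6 : Pattern 8 where
  lab := !![0, 0, 0, 0;
            0, 1, 2, 2;
            1, 2, 0, 4;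
            1, 3, 2, 6;
            2, 1, 3, 5;
            2, 0, 1, 7;
            3, 2, 1, 3;
            3, 3, 3, 1]
  ne := ![oneParam, oneParam, oneParam, [(2, 0), (2, 6), (4, 0), (4, 6), (6, 0)]]

/-- The sixth array with `i₃ = i₂`. -/
def pattern6special : Pattern 8 where
  lab := !![0, 0, 0, 0;
            0, 1, 2, 2;
            1, 2, 0, 2;
            1, 3, 2, 4;
            2, 1, 3, 3;
            2, 0, 1, 5;
            3, 2, 1, 3;
            3, 3, 3, 1]
  ne := ![oneParam, oneParam, oneParam, (2, 4) :: (2, 5) :: twoParams]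


/-! ### From patterns to entangled states -/

theorem Pattern.Realizes.tail {p : Pattern 8} {q : Fin 4 → ℕ → Qubit} {F : Array84}
    (h : p.Realizes q F) : p.tail.Realizes q fun i : Fin 7 => F i.succ :=
  ⟨fun i s => h.parallel i.succ s, h.distinct⟩

theorem alpha_of_realizes {p : Pattern 8} {q : Fin 4 → ℕ → Qubit} {F : Array84}
    (h : p.Realizes q F) (l : List (List (Fin 8))) (ho : p.orthogonal = true)
    (hb : p.boundedBy l = true) (hl : l.length < 8) :
    IsPPTEntangledInAllSenses (alpha F) ∧ (alpha F).rank = 8 := by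
  have hc : (0 : ℂ) < 1 / 8 := by norm_num
  obtain ⟨hfin, hcard⟩ := h.finite_and_ncard_le ho hc.ne' hb
  refine ⟨isPPTEntangledInAllSenses_complement (h.orthogonalRows ho) hc (by norm_num) hfin
    (by omega), ?_⟩
  have := rank_complement (h.orthogonalRows ho).orthonormal hc.ne'
  exact Nat.add_right_cancel this

/-- The first four sets in `l` are required to have product vectors for all parameters. -/
theorem beta_of_realizes {p : Pattern 8} {q : Fin 4 → ℕ → Qubit} {F : Array84}
    (h : p.Realizes q F) (l : List (List (Fin 7))) (ho : p.tail.orthogonal = true)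
    (hb : p.tail.boundedBy l = true) (hl : l.length < 9) (hl' : 4 ≤ l.length)
    (ha : p.tail.admits (l.take 4) = true) (hs : p.tail.separated (l.take 4) = true) :
    IsPPTEntangledInAllSenses (beta F) ∧ (beta F).rank = 9 ∧
      (productRaysInRange (beta F)).Finite ∧ 4 ≤ (productRaysInRange (beta F)).ncard ∧
      (productRaysInRange (beta F)).ncard < 9 := by
  have hc : (0 : ℂ) < 1 / 9 := by norm_num
  obtain ⟨hfin, hcard⟩ := h.tail.finite_and_ncard_le ho hc.ne' hb
  have hlow := h.tail.length_le_ncard ho hc.ne' ha hs hfin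
  rw [List.length_take, min_eq_left hl'] at hlow
  have hrank := rank_complement (h.tail.orthogonalRows ho).orthonormal hc.ne'
  exact ⟨isPPTEntangledInAllSenses_complement (h.tail.orthogonalRows ho) hc (by norm_num) hfin
    (by omega), Nat.add_right_cancel hrank, hfin, hlow, hcard.trans_lt hl⟩

/-! ### The six families -/

theorem distinct_oneParam {q : ℕ → Qubit} (h : Generic (q 0)) :
    ∀ d ∈ oneParam, Distinct (val q d.1) (val q d.2) := by
  simp only [oneParam, List.forall_mem_cons]
  exact ⟨h.1, h.2, List.forall_mem_nil _⟩

theorem distinct_twoParams {q : ℕ → Qubit} (h : Generic (q 0)) (h' : Generic (q 1)) :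
    ∀ d ∈ twoParams, Distinct (val q d.1) (val q d.2) := by
  simp only [twoParams, List.forall_mem_cons]
  exact ⟨h.1, h.2, h'.1, h'.2, List.forall_mem_nil _⟩

theorem realizes_pattern1 {F : Array84} (hF : F ∈ family1) : ∃ q, pattern1.Realizes q F := by
  obtain ⟨f5, g3, h3, i3, i4, hf, hg, hh, hi3, hi, hi4, rfl⟩ := hF
  refine ⟨params ![[f5], [g3], [h3], [i3, i4]], fun i s => ?_, fun s => ?_⟩
  · fin_cases i <;> fin_cases s <;> exact Parallel.refl _
  · fin_cases s
    exacts [distinct_oneParam hf, distinct_oneParam hg, distinct_oneParam hh,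
      List.forall_mem_cons.2 ⟨hi, distinct_twoParams hi3 hi4⟩]

theorem realizes_pattern2 {F : Array84} (hF : F ∈ family2) : ∃ q, pattern2.Realizes q F := by
  obtain ⟨f5, g3, h3, i2, i3, i4, hf, hg, hh, hi2, hi, hi', rfl⟩ := hF
  refine ⟨params ![[f5], [g3], [h3], [i2, i3, i4]], fun i s => ?_, fun s => ?_⟩
  · fin_cases i <;> fin_cases s <;> exact Parallel.refl _
  · fin_cases s
    exacts [distinct_oneParam hf, distinct_oneParam hg, distinct_oneParam hh,
      List.forall_mem_cons.2 ⟨hi, List.forall_mem_cons.2 ⟨hi', distinct_oneParam hi2⟩⟩]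

theorem realizes_pattern2special {F : Array84} (hF : F ∈ family2special) :
    ∃ q, pattern2special.Realizes q F := by
  obtain ⟨f5, g3, h3, i2, hf, hg, hh, hi2, rfl⟩ := hF
  refine ⟨params ![[f5], [g3], [h3], [i2]], fun i s => ?_, fun s => ?_⟩
  · fin_cases i <;> fin_cases s <;>
      first | exact Parallel.refl _ | exact parallel_perp_k0.symm
  · fin_cases s
    exacts [distinct_oneParam hf, distinct_oneParam hg, distinct_oneParam hh,
      distinct_oneParam hi2]

theorem realizes_pattern3 {F : Array84} (hF : F ∈ family3) :
    ∃ q, (pattern3 []).Realizes q F := by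
  obtain ⟨f5, g3, h3, h4, i2, hf, hg, hh3, hh, hh4, hi2, rfl⟩ := hF
  refine ⟨params ![[f5], [g3], [h3, h4], [i2]], fun i s => ?_, fun s => ?_⟩
  · fin_cases i <;> fin_cases s <;> exact Parallel.refl _
  · fin_cases s
    exacts [distinct_oneParam hf, distinct_oneParam hg,
      List.forall_mem_cons.2 ⟨hh, distinct_twoParams hh3 hh4⟩, distinct_oneParam hi2]

/-- Whether `h₄ = h₃'` affects which product vectors exist. -/
theorem realizes_pattern3_or {F : Array84} (hF : F ∈ family3) :
    (∃ q, (pattern3 [(2, 5)]).Realizes q F) ∨ ∃ q, pattern3perp.Realizes q F := by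
  obtain ⟨f5, g3, h3, h4, i2, hf, hg, hh3, hh, hh4, hi2, rfl⟩ := hF
  by_cases h : Distinct h3 (perp h4)
  · refine Or.inl ⟨params ![[f5], [g3], [h3, h4], [i2]], fun i s => ?_, fun s => ?_⟩
    · fin_cases i <;> fin_cases s <;> exact Parallel.refl _
    · fin_cases s
      exacts [distinct_oneParam hf, distinct_oneParam hg,
        List.forall_mem_cons.2 ⟨h, List.forall_mem_cons.2 ⟨hh, distinct_twoParams hh3 hh4⟩⟩,
        distinct_oneParam hi2]
  · have h₁ : Parallel h3 (perp h4) := parallel_of_not_distinct h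
    have h₂ : Parallel (perp h3) h4 := h₁.perp.trans (parallel_perp_perp h4)
    refine Or.inr ⟨params ![[f5], [g3], [h3], [i2]], fun i s => ?_, fun s => ?_⟩
    · fin_cases i <;> fin_cases s <;> first | exact Parallel.refl _ | exact h₁ | exact h₂
    · fin_cases s
      exacts [distinct_oneParam hf, distinct_oneParam hg, distinct_oneParam hh3,
        distinct_oneParam hi2]

theorem realizes_pattern4 {F : Array84} (hF : F ∈ family4) : ∃ q, pattern4.Realizes q F := by
  obtain ⟨f5, g3, g4, h3, i2, i3, hf, hg3, hg, hg', hg4, hh, hi2, hi, hi', hi3, rfl⟩ := hF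
  refine ⟨params ![[f5], [g3, g4], [h3], [i2, i3]], fun i s => ?_, fun s => ?_⟩
  · fin_cases i <;> fin_cases s <;> exact Parallel.refl _
  · fin_cases s
    exacts [distinct_oneParam hf,
      List.forall_mem_cons.2 ⟨hg, List.forall_mem_cons.2 ⟨hg', distinct_twoParams hg3 hg4⟩⟩,
      distinct_oneParam hh,
      List.forall_mem_cons.2 ⟨hi, List.forall_mem_cons.2 ⟨hi', distinct_twoParams hi2 hi3⟩⟩]

theorem realizes_pattern5 {F : Array84} (hF : F ∈ family5) :
    ∃ q, (pattern5 []).Realizes q F := by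
  obtain ⟨f5, f6, g3, h3, i2, hf5, hf, hf6, hg, hh, hi2, rfl⟩ := hF
  refine ⟨params ![[f5, f6], [g3], [h3], [i2]], fun i s => ?_, fun s => ?_⟩
  · fin_cases i <;> fin_cases s <;> exact Parallel.refl _
  · fin_cases s
    exacts [List.forall_mem_cons.2 ⟨hf, distinct_twoParams hf5 hf6⟩, distinct_oneParam hg,
      distinct_oneParam hh, distinct_oneParam hi2]

/-- Whether `f₆ = f₅'` affects which product vectors exist. -/
theorem realizes_pattern5_or {F : Array84} (hF : F ∈ family5) :
    (∃ q, (pattern5 [(2, 5)]).Realizes q F) ∨ ∃ q, pattern5perp.Realizes q F := by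
  obtain ⟨f5, f6, g3, h3, i2, hf5, hf, hf6, hg, hh, hi2, rfl⟩ := hF
  by_cases h : Distinct f5 (perp f6)
  · refine Or.inl ⟨params ![[f5, f6], [g3], [h3], [i2]], fun i s => ?_, fun s => ?_⟩
    · fin_cases i <;> fin_cases s <;> exact Parallel.refl _
    · fin_cases s
      exacts [List.forall_mem_cons.2 ⟨h, List.forall_mem_cons.2 ⟨hf, distinct_twoParams hf5 hf6⟩⟩,
        distinct_oneParam hg, distinct_oneParam hh, distinct_oneParam hi2]
  · have h₁ : Parallel f5 (perp f6) := parallel_of_not_distinct h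
    have h₂ : Parallel (perp f5) f6 := h₁.perp.trans (parallel_perp_perp f6)
    refine Or.inr ⟨params ![[f5], [g3], [h3], [i2]], fun i s => ?_, fun s => ?_⟩
    · fin_cases i <;> fin_cases s <;> first | exact Parallel.refl _ | exact h₁ | exact h₂
    · fin_cases s
      exacts [distinct_oneParam hf5, distinct_oneParam hg, distinct_oneParam hh,
        distinct_oneParam hi2]

theorem realizes_pattern6 {F : Array84} (hF : F ∈ family6) : ∃ q, pattern6.Realizes q F := by
  obtain ⟨f5, g3, h2, i2, i3, i4, hf, hg, hh, hi, rfl⟩ := hF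
  have key : Distinct i2 k0 ∧ Distinct i2 i4 ∧ Distinct i3 k0 ∧ Distinct i3 i4 ∧
      Distinct i4 k0 := by
    rcases hi with ⟨h1, -, h2, h3, h4, h5⟩ | ⟨rfl, h1, h2, h3, h4⟩
    · exact ⟨h1, h2, h3, h4, h5.1⟩
    · exact ⟨h1.1, h2, h1.2.perp_perp.of_parallel (Parallel.refl _) parallel_perp_k1,
        h3.perp_perp.of_parallel (Parallel.refl _) (parallel_perp_perp i4), h4⟩
  obtain ⟨k1, k2, k3, k4, k5⟩ := key
  refine ⟨params ![[f5], [g3], [h2], [i2, i3, i4]], fun i s => ?_, fun s => ?_⟩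
  · fin_cases i <;> fin_cases s <;> exact Parallel.refl _
  · fin_cases s
    exacts [distinct_oneParam hf, distinct_oneParam hg, distinct_oneParam hh,
      List.forall_mem_cons.2 ⟨k1, List.forall_mem_cons.2 ⟨k2, List.forall_mem_cons.2 ⟨k3,
        List.forall_mem_cons.2 ⟨k4, List.forall_mem_cons.2 ⟨k5, List.forall_mem_nil _⟩⟩⟩⟩⟩]

theorem realizes_pattern6special {F : Array84} (hF : F ∈ family6special) :
    ∃ q, pattern6special.Realizes q F := by
  obtain ⟨f5, g3, h2, i2, i4, hf, hg, hh, hi2, hi, hi', hi4, rfl⟩ := hF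
  refine ⟨params ![[f5], [g3], [h2], [i2, i4]], fun i s => ?_, fun s => ?_⟩
  · fin_cases i <;> fin_cases s <;> exact Parallel.refl _
  · fin_cases s
    exacts [distinct_oneParam hf, distinct_oneParam hg, distinct_oneParam hh,
      List.forall_mem_cons.2 ⟨hi, List.forall_mem_cons.2 ⟨hi', distinct_twoParams hi2 hi4⟩⟩]

end FourQubit

open FourQubit in
theorem mainTheorem2 :
    (∀ F : FourQubit.Array84,
      F ∈ FourQubit.family1 ∪ FourQubit.family2 ∪ FourQubit.family3 ∪
          FourQubit.family4 ∪ FourQubit.family5 ∪ FourQubit.family6 →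
        FourQubit.IsPPTEntangledInAllSenses (FourQubit.alpha F) ∧
        (FourQubit.alpha F).rank = 8) ∧
    (∀ F : FourQubit.Array84,
      F ∈ FourQubit.family1 ∪ FourQubit.family2special ∪ FourQubit.family3 ∪
          FourQubit.family4 ∪ FourQubit.family5 ∪ FourQubit.family6special →
        FourQubit.IsPPTEntangledInAllSenses (FourQubit.beta F) ∧
        (FourQubit.beta F).rank = 9 ∧
        (FourQubit.productRaysInRange (FourQubit.beta F)).Finite ∧
        4 ≤ (FourQubit.productRaysInRange (FourQubit.beta F)).ncard ∧
        (FourQubit.productRaysInRange (FourQubit.beta F)).ncard < 9) := by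
  -- the rows are numbered from `0`, and from `0` again when the first row is removed
  constructor
  · rintro F (((((hF | hF) | hF) | hF) | hF) | hF)
    · obtain ⟨q, h⟩ := realizes_pattern1 hF
      exact alpha_of_realizes h [] (by decide +kernel) (by decide +kernel) (by decide)
    · obtain ⟨q, h⟩ := realizes_pattern2 hF
      exact alpha_of_realizes h [] (by decide +kernel) (by decide +kernel) (by decide)
    · obtain ⟨q, h⟩ := realizes_pattern3 hF
      exact alpha_of_realizes h [] (by decide +kernel) (by decide +kernel) (by decide)
    · obtain ⟨q, h⟩ := realizes_pattern4 hF
      exact alpha_of_realizes h [[0, 3, 4, 6], [0, 2, 5, 6], [1, 3, 4, 7], [1, 2, 5, 7]]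
        (by decide +kernel) (by decide +kernel) (by decide)
    · obtain ⟨q, h⟩ := realizes_pattern5 hF
      exact alpha_of_realizes h [] (by decide +kernel) (by decide +kernel) (by decide)
    · obtain ⟨q, h⟩ := realizes_pattern6 hF
      exact alpha_of_realizes h [[0, 3, 4], [0, 3, 6], [1, 5, 7], [2, 5, 7]]
        (by decide +kernel) (by decide +kernel) (by decide)
  · rintro F (((((hF | hF) | hF) | hF) | hF) | hF)
    · obtain ⟨q, h⟩ := realizes_pattern1 hF
      exact beta_of_realizes h [[0, 1, 2, 6], [0, 3, 4, 6], [2, 3, 5, 6], [1, 4, 5, 6],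
        [0, 1, 3], [0, 2, 4], [1, 3, 5], [2, 4, 5]] (by decide +kernel) (by decide +kernel)
        (by decide) (by decide) (by decide +kernel) (by decide +kernel)
    · obtain ⟨q, h⟩ := realizes_pattern2special hF
      exact beta_of_realizes h [[0, 1, 2, 5], [0, 3, 4, 5], [2, 3, 5, 6], [1, 4, 5, 6],
        [2, 3, 4], [1, 3, 5], [0, 3, 6]] (by decide +kernel) (by decide +kernel)
        (by decide) (by decide) (by decide +kernel) (by decide +kernel)
    · obtain ⟨q, h⟩ | ⟨q, h⟩ := realizes_pattern3_or hF
      · exact beta_of_realizes h [[0, 1, 2, 5], [0, 3, 4, 5], [2, 3, 5, 6], [1, 4, 5, 6],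
          [2, 3, 4], [2, 4, 5], [0, 3, 6]] (by decide +kernel) (by decide +kernel)
          (by decide) (by decide) (by decide +kernel) (by decide +kernel)
      · exact beta_of_realizes h [[0, 1, 2, 5], [0, 3, 4, 5], [2, 3, 5, 6], [1, 4, 5, 6],
          [0, 1, 3], [0, 2, 4]] (by decide +kernel) (by decide +kernel)
          (by decide) (by decide) (by decide +kernel) (by decide +kernel)
    · obtain ⟨q, h⟩ := realizes_pattern4 hF
      exact beta_of_realizes h [[0, 1, 3], [0, 2, 4], [0, 1, 2, 5], [0, 3, 4, 5],
        [2, 3, 5], [1, 4, 5], [0, 2, 3, 6], [0, 1, 4, 6]] (by decide +kernel) (by decide +kernel)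
        (by decide) (by decide) (by decide +kernel) (by decide +kernel)
    · obtain ⟨q, h⟩ | ⟨q, h⟩ := realizes_pattern5_or hF
      · exact beta_of_realizes h [[1, 2, 3], [0, 1, 2, 5], [0, 1, 6], [3, 5, 6],
          [0, 2, 3, 6], [0, 3, 4, 6], [2, 3, 5, 6], [1, 4, 5, 6]]
          (by decide +kernel) (by decide +kernel)
          (by decide) (by decide) (by decide +kernel) (by decide +kernel)
      · exact beta_of_realizes h [[1, 2, 3], [0, 1, 2, 5], [0, 1, 6], [0, 3, 5, 6],
          [1, 3, 4, 5], [2, 3, 4, 6]] (by decide +kernel) (by decide +kernel)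
          (by decide) (by decide) (by decide +kernel) (by decide +kernel)
    · obtain ⟨q, h⟩ := realizes_pattern6special hF
      exact beta_of_realizes h [[0, 1, 2, 3], [2, 4, 5], [1, 3, 4, 5], [1, 4, 6],
        [2, 3, 4, 6], [0, 3, 5, 6], [0, 3, 4]] (by decide +kernel) (by decide +kernel)
        (by decide) (by decide) (by decide +kernel) (by decide +kernel)
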